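/- Let $f(x)=f_0x^m+\dots+f_m$ and $g(x)=g_0x^n+\dots+g_n$ be complex polynomials with $f_0g_0\neq 0$ and $m<n<2m+1$, and consider the Liénard system $x_t=y$, $y_t=-f(x)y-g(x)$. A non-constant polynomial $F\in\mathbb{C}[x,y]$ is an invariant algebraic curve of it with cofactor $\lambda\in\mathbb{C}[x,y]$ if $$yF_x-\bigl(f(x)y+g(x)\bigr)F_y=\lambda F .$$ Consider also the equation $$y\,y_x+f(x)y+g(x)=0 \qquad (*)$$ for formal Laurent series $y(x)\in\mathbb{C}((x^{-1}))$ near $x=\infty$, and let $\{W\}_+$ denote the polynomial part of $W\in\mathbb{C}((x^{-1}))[y]$, i.e. the sum of its monomials $c\,x^iy^j$ with $i,j\ge 0$. Then the following hold. (a) There are polynomials $$q(x)=-\frac{f_0}{m+1}x^{m+1}+\sum_{l=1}^{m}q_{m+1-l}x^l,\qquad p(x)=-\frac{g_0}{f_0}x^{n-m}+\sum_{l=1}^{n-m-1}p_{n-m-l}x^l,$$ each of which is uniquely determined by $f$ and $g$: $q$ is the only polynomial of the first form with $\deg(qq_x+fq+g)\le m$, and $p$ is the only polynomial of the second form with $\deg(pp_x+fp+g)\le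 m$. (b) Every solution of $(*)$ with leading term $-\frac{f_0}{m+1}x^{m+1}$ (a series of type (I)) has the form $y=q(x)+\sum_{l\ge 0}c_{m+1+l}x^{-l}$, where each $c_{m+1+l}$, $l\ge 1$, is a polynomial in $c_{m+1}$ that depends only on $f$, $g$ and $l$. (Such solutions need not exist.) (c) There is exactly one solution of $(*)$ with leading term $-\frac{g_0}{f_0}x^{n-m}$ (the series of type (II)), and it has the form $y_{II}=p(x)+\sum_{l\ge 0}b_{l}x^{-l}$. (d) For every irreducible invariant algebraic curve $F\in\mathbb{C}[x,y]\setminus\mathbb{C}$ of the system, with cofactor $\lambda$, there are an integer $N\ge 1$, a number $k\in\{0,1\}$, a constant $\mu\in\mathbb{C}\setminus\{0\}$ and solutions $y_j(x)=q(x)+\sum_{l\ge 0}c^{(j)}_{m+1+l}x^{-l}$, $j=1,\dots,N-k$, of $(*)$ of type (I) with pairwise distinct coefficients $c^{(1)}_{m+1},\dots,c^{(N-k)}_{m+1}$, the other coefficients being given by the polynomials of (b), such that $$F(x,y)=\mu\Bigl\{\prod_{j=1}^{N-k}\bigl(y-y_j(x)\bigr)\cdot\bigl(y-y_{II}(x)\bigr)^{k}\Bigr\}_+,\qquad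 \lambda(x,y)=-Nf-(N-k)q_x-kp_x,$$ where the product over $j$ is $1$ if $N=k=1$. -/

import Mathlib

open Polynomial
open scoped Polynomial.Bivariate

noncomputable section

namespace Lienard

/-! ### Invariant algebraic curves of planar polynomial vector fields

The ring `ℂ[x, y]` is `ℂ[X][Y]`: the inner variable is `x`, the outer one is `y`. -/

/-- The partial derivative `∂F/∂x`, i.e. differentiation of the coefficients (which are polynomials
in `x`). The partial derivative `∂F/∂y` is `Polynomial.derivative F`. -/
def partialX (F : ℂ[X][Y]) : ℂ[X][Y] :=
  F.sum fun i a => monomial i (derivative a)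

theorem coeff_partialX (F : ℂ[X][Y]) (i : ℕ) :
    (partialX F).coeff i = derivative (F.coeff i) := by
  simp only [partialX, Polynomial.sum_def, finsetSum_coeff, coeff_monomial]
  rw [Finset.sum_ite_eq' F.support i]
  by_cases h : i ∈ F.support
  · simp [h]
  · simp [notMem_support_iff.mp h]

/-- `F` is a non-constant polynomial defining an invariant algebraic curve, with cofactor `L`, of
the vector field `P ∂/∂x + Q ∂/∂y`. -/
def IsInvariantCurve (P Q F L : ℂ[X][Y]) : Prop :=
  (∀ a : ℂ, F ≠ C (C a)) ∧ P * partialX F + Q * derivative F = L * F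

/-- `F` defines an invariant algebraic curve with cofactor `L` of the Liénard system
`x_t = y`, `y_t = -f(x) y - g(x)`. -/
def IsLienardInvariantCurve (f g : ℂ[X]) (F L : ℂ[X][Y]) : Prop :=
  IsInvariantCurve Y (-(C f * Y) - C g) F L

/-! ### Formal Laurent series at `x = ∞`

The field of formal Laurent series at `x = ∞` is `ℂ((t))` with `t = x⁻¹`. -/

/-- The coefficient of `x ^ i` in a Laurent series at infinity. -/
def coeffX (y : LaurentSeries ℂ) (i : ℤ) : ℂ := y.coeff (-i)

/-- The embedding of `ℂ[x]` in the field of Laurent series at infinity, `x ↦ t⁻¹`. -/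
def ofPoly : ℂ[X] →+* LaurentSeries ℂ :=
  Polynomial.eval₂RingHom HahnSeries.C (HahnSeries.single (-1 : ℤ) (1 : ℂ))

theorem coeffX_ofPoly (p : ℂ[X]) (i : ℕ) : coeffX (ofPoly p) i = p.coeff i := by
  rw [ofPoly, coeffX, coe_eval₂RingHom, eval₂_eq_sum_range, HahnSeries.coeff_sum]
  rw [Finset.sum_eq_single i]
  · simp
  · intro b _ hb
    have h : -(i : ℤ) ≠ -(b : ℤ) := by omega
    simp [HahnSeries.coeff_single_of_ne h]
  · intro h
    rw [Finset.mem_range] at h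
    simp [coeff_eq_zero_of_natDegree_lt (show p.natDegree < i by omega)]

/-- The series `∑_{l ≥ 0} c_l x^{-l}`. -/
def tail (c : ℕ → ℂ) : LaurentSeries ℂ :=
  HahnSeries.ofPowerSeries ℤ ℂ (PowerSeries.mk c)

/-- The derivation `d/dx = -t² d/dt`. -/
def derivX (y : LaurentSeries ℂ) : LaurentSeries ℂ :=
  -(HahnSeries.single (2 : ℤ) (1 : ℂ) * LaurentSeries.derivative ℂ y)

theorem coeffX_derivX (y : LaurentSeries ℂ) (i : ℤ) :
    coeffX (derivX y) (i - 1) = i * coeffX y i := by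
  have h : -(i - 1) = (-i - 1) + 2 := by ring
  rw [coeffX, derivX, coeffX, HahnSeries.coeff_neg, h,
    HahnSeries.coeff_single_mul_add, LaurentSeries.derivative_apply, LaurentSeries.hasseDeriv_coeff]
  simp

/-- `y` is a solution of `y y_x + f(x) y + g(x) = 0`. -/
def IsSolution (f g : ℂ[X]) (y : LaurentSeries ℂ) : Prop :=
  y * derivX y + ofPoly f * y + ofPoly g = 0

/-- The leading term of `y` at infinity is `a x ^ r`. -/
def HasLeadingTerm (y : LaurentSeries ℂ) (a : ℂ) (r : ℤ) : Prop :=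
  a ≠ 0 ∧ coeffX y r = a ∧ ∀ i : ℤ, r < i → coeffX y i = 0

/-- The polynomial part of a Laurent series at infinity. -/
def polyPartX (y : LaurentSeries ℂ) : ℂ[X] :=
  ∑ i ∈ Finset.range ((-y.order).toNat + 1), monomial i (coeffX y i)

theorem coeff_polyPartX (y : LaurentSeries ℂ) (i : ℕ) :
    (polyPartX y).coeff i = coeffX y i := by
  simp only [polyPartX, finsetSum_coeff, coeff_monomial]
  rw [Finset.sum_ite_eq' (Finset.range _) i]
  split_ifs with h
  · rfl
  · rw [coeffX, HahnSeries.coeff_eq_zero_of_lt_order]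
    rw [Finset.mem_range] at h
    omega

/-- The polynomial part `{W}_+` of a polynomial `W` in `y` whose coefficients are Laurent series at
infinity: the sum of the monomials `c x^i y^j` of `W` with `i ≥ 0` and `j ≥ 0`. -/
def polyPart (W : (LaurentSeries ℂ)[X]) : ℂ[X][Y] :=
  W.sum fun j a => monomial j (polyPartX a)

theorem coeff_polyPart (W : (LaurentSeries ℂ)[X]) (i j : ℕ) :
    ((polyPart W).coeff j).coeff i = coeffX (W.coeff j) i := by
  rw [polyPart, Polynomial.sum_def, finsetSum_coeff]
  simp only [coeff_monomial]
  rw [Finset.sum_ite_eq' W.support j]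
  by_cases h : j ∈ W.support
  · simp [h, coeff_polyPartX]
  · simp [notMem_support_iff.mp h, coeffX]

/-! ### The polynomials `q` and `p` and the series of types (I) and (II) -/

/-- `r = a x^d + (terms of degree between 1 and d - 1)`, and substituting `r` into
`y y_x + f y + g` cancels all the powers of `x` above `x ^ deg f`. -/
structure IsPrincipalPart (f g : ℂ[X]) (a : ℂ) (d : ℕ) (r : ℂ[X]) : Prop where
  natDegree_eq : r.natDegree = d
  leadingCoeff_eq : r.leadingCoeff = a
  coeff_zero_eq : r.coeff 0 = 0
  residual : (r * derivative r + f * r + g).natDegree ≤ f.natDegree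

/-- The leading coefficient `-f₀ / (m + 1)` of `q`. -/
def leadI (f : ℂ[X]) : ℂ := -f.leadingCoeff / ((f.natDegree : ℂ) + 1)

/-- The leading coefficient `-g₀ / f₀` of `p`. -/
def leadII (f g : ℂ[X]) : ℂ := -g.leadingCoeff / f.leadingCoeff

end Lienard

end

/-! Put m = deg f and n = deg g. Near a polynomial whose coefficient of `x ^ (m + 1)` is A, adding β
x^i changes the coefficient of `x ^ (m + i)` in y y_x + f y + g by β (f₀ + (m + 1 + i) A). For type
(I) the bracket is i A and vanishes only at i = 0; for type (II) A = 0 and it is f₀. All powers of x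
except x^0 are therefore determined one after another. At x^0 type (II) is determined too, while
type (I) has a free constant term, subject to the condition that the coefficient ρ of `x ^ m` in q
q_x + f q + g vanishes. This gives (a), (b) and (c); `IsBalance` treats both types at once.

For (d), let D be the derivation along the vector field. Comparing top powers of y shows that F has
a constant leading coefficient in y and that λ depends on x only. By Gauss's lemma the monic
multiple of F is separable over the Laurent series. Instead of factoring it over Puiseux series, the
proof extracts the roots inside ℂ((x⁻¹)).

If z solves (*), then (D W)(z) = z (W(z))_x. Remove the factor y - y_II if it occurs; the cofactor V
has V(y_II) ≠ 0, so evaluation at y_II, whose order is n - m ≤ m, bounds the eigenvalue of V by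
order m - 1 (`ordLE_eigenvalue`). With this bound, substituting y = q + w makes all coefficients of
V have order at most 0 and forces ρ = 0 unless V = 1 (`shift_integral`). A root c₀ of the reduction
modulo x⁻¹ then gives a type (I) series with constant term c₀, which is an exact root of V
(`exists_root`). Removing it keeps the bound on the eigenvalue, so V splits into type (I) factors by
induction. Separability makes the constant terms distinct, and the eigenvalues of the linear factors
add up to λ. -/

noncomputable section

namespace Lienard

/-! ### Orders at infinity -/

/-- No power of `x` above `x ^ d` occurs in `y`. -/
def OrdLE (y : LaurentSeries ℂ) (d : ℤ) : Prop := ∀ i : ℤ, d < i → coeffX y i = 0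

theorem ext_coeffX {y z : LaurentSeries ℂ} (h : ∀ i, coeffX y i = coeffX z i) : y = z := by
  ext i
  simpa [coeffX] using h (-i)

@[simp] theorem coeffX_zero (i : ℤ) : coeffX 0 i = 0 := rfl

@[simp] theorem coeffX_add (y z : LaurentSeries ℂ) (i : ℤ) :
    coeffX (y + z) i = coeffX y i + coeffX z i := rfl

@[simp] theorem coeffX_neg (y : LaurentSeries ℂ) (i : ℤ) : coeffX (-y) i = -coeffX y i := rfl

@[simp] theorem coeffX_sub (y z : LaurentSeries ℂ) (i : ℤ) :
    coeffX (y - z) i = coeffX y i - coeffX z i := by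
  simp [coeffX]

theorem coeffX_single_mul (y : LaurentSeries ℂ) (d i : ℤ) :
    coeffX (HahnSeries.single d 1 * y) i = coeffX y (i + d) := by
  rw [coeffX, HahnSeries.coeff_single_mul, one_mul, coeffX]
  congr 1
  ring

theorem coeffX_ofPowerSeries_neg (P : PowerSeries ℂ) (l : ℕ) :
    coeffX (HahnSeries.ofPowerSeries ℤ ℂ P) (-(l : ℤ)) = PowerSeries.coeff l P := by
  rw [coeffX, neg_neg, HahnSeries.ofPowerSeries_apply_coeff]

theorem ordLE_ofPowerSeries (P : PowerSeries ℂ) :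
    OrdLE (HahnSeries.ofPowerSeries ℤ ℂ P) 0 := by
  intro i hi
  rw [coeffX, PowerSeries.coeff_coe, if_pos (by omega)]

theorem coeffX_tail_neg (c : ℕ → ℂ) (l : ℕ) : coeffX (tail c) (-(l : ℤ)) = c l := by
  rw [tail, coeffX_ofPowerSeries_neg, PowerSeries.coeff_mk]

theorem ordLE_tail (c : ℕ → ℂ) : OrdLE (tail c) 0 := ordLE_ofPowerSeries _

namespace OrdLE

variable {y z : LaurentSeries ℂ} {d e : ℤ}

theorem mono (hy : OrdLE y d) (h : d ≤ e) : OrdLE y e := fun i hi => hy i (h.trans_lt hi)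

theorem add (hy : OrdLE y d) (hz : OrdLE z d) : OrdLE (y + z) d := fun i hi => by
  rw [coeffX_add, hy i hi, hz i hi, add_zero]

theorem neg (hy : OrdLE y d) : OrdLE (-y) d := fun i hi => by
  rw [coeffX_neg, hy i hi, neg_zero]

theorem pred (hy : OrdLE y d) (h : coeffX y d = 0) : OrdLE y (d - 1) := fun i hi => by
  rcases (show d ≤ i by omega).eq_or_lt with rfl | hlt
  · exact h
  · exact hy i hlt

theorem exists_powerSeries (hy : OrdLE y d) :
    ∃ P : PowerSeries ℂ, y = HahnSeries.single (-d) 1 * HahnSeries.ofPowerSeries ℤ ℂ P := by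
  refine ⟨PowerSeries.mk fun l => coeffX y (d - l), ext_coeffX fun i => ?_⟩
  rw [coeffX_single_mul]
  by_cases hi : d < i
  · rw [hy i hi, ordLE_ofPowerSeries _ _ (by omega)]
  · obtain ⟨l, hl⟩ := Int.eq_ofNat_of_zero_le (show 0 ≤ d - i by omega)
    rw [show i + -d = -(l : ℤ) by omega, coeffX_ofPowerSeries_neg, PowerSeries.coeff_mk,
      show d - (l : ℤ) = i by omega]

theorem mul_aux (hy : OrdLE y d) (hz : OrdLE z e) :
    OrdLE (y * z) (d + e) ∧ coeffX (y * z) (d + e) = coeffX y d * coeffX z e := by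
  obtain ⟨P, rfl⟩ := hy.exists_powerSeries
  obtain ⟨Q, rfl⟩ := hz.exists_powerSeries
  have h : HahnSeries.single (-d) (1 : ℂ) * HahnSeries.ofPowerSeries ℤ ℂ P *
      (HahnSeries.single (-e) (1 : ℂ) * HahnSeries.ofPowerSeries ℤ ℂ Q) =
      HahnSeries.single (-(d + e)) (1 : ℂ) * HahnSeries.ofPowerSeries ℤ ℂ (P * Q) := by
    rw [mul_mul_mul_comm, HahnSeries.single_mul_single, mul_one,
      map_mul (HahnSeries.ofPowerSeries ℤ ℂ), neg_add]
  have h0 (R : PowerSeries ℂ) : coeffX (HahnSeries.ofPowerSeries ℤ ℂ R) 0 =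
      PowerSeries.constantCoeff R := by
    simpa using coeffX_ofPowerSeries_neg R 0
  rw [h]
  refine ⟨fun i hi => ?_, ?_⟩
  · rw [coeffX_single_mul, ordLE_ofPowerSeries _ _ (by omega)]
  · simp only [coeffX_single_mul, add_neg_cancel, h0]
    exact map_mul PowerSeries.constantCoeff P Q

theorem mul (hy : OrdLE y d) (hz : OrdLE z e) : OrdLE (y * z) (d + e) := (hy.mul_aux hz).1

theorem coeffX_mul (hy : OrdLE y d) (hz : OrdLE z e) :
    coeffX (y * z) (d + e) = coeffX y d * coeffX z e := (hy.mul_aux hz).2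

theorem derivX (hy : OrdLE y d) : OrdLE (derivX y) (d - 1) := fun i hi => by
  rw [show i = i + 1 - 1 by ring, coeffX_derivX, hy _ (by omega), mul_zero]

end OrdLE

theorem ordLE_neg_order (y : LaurentSeries ℂ) : OrdLE y (-y.order) := fun i hi => by
  rw [coeffX, HahnSeries.coeff_eq_zero_of_lt_order (by omega)]

theorem exists_leading {y : LaurentSeries ℂ} (hy : y ≠ 0) :
    ∃ d, OrdLE y d ∧ coeffX y d ≠ 0 := by
  refine ⟨-y.order, ordLE_neg_order y, ?_⟩
  rw [coeffX, neg_neg]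
  exact HahnSeries.coeff_order_eq_zero.not.mpr hy

/-- Cancellation of a factor of exact order `s`. -/
theorem ordLE_of_mul {y u : LaurentSeries ℂ} {s e : ℤ} (hu : OrdLE u s) (hs : coeffX u s ≠ 0)
    (h : OrdLE (y * u) (e + s)) : OrdLE y e := by
  by_cases hy : y = 0
  · subst hy
    intro i _
    rfl
  obtain ⟨d, hd, hd0⟩ := exists_leading hy
  rcases le_or_gt d e with hde | hde
  · exact hd.mono hde
  · exact absurd ((hd.coeffX_mul hu).symm.trans (h _ (by omega))) (mul_ne_zero hd0 hs)

/-! ### The derivation `d/dx` and the embedding of polynomials -/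

@[simp] theorem derivX_add (y z : LaurentSeries ℂ) : derivX (y + z) = derivX y + derivX z := by
  simp only [derivX, map_add]
  ring

@[simp] theorem derivX_zero : derivX 0 = 0 := by simp [derivX]

theorem derivX_neg (y : LaurentSeries ℂ) : derivX (-y) = -derivX y := by
  simp only [derivX, map_neg]
  ring

theorem coeff_derivX (y : LaurentSeries ℂ) (i : ℤ) :
    (derivX y).coeff i = -((i : ℂ) - 1) * y.coeff (i - 1) := by
  have h := coeffX_derivX y (1 - i)
  rw [coeffX, coeffX] at h
  rw [show -((1 - i) - 1) = i by ring, show -(1 - i) = i - 1 by ring] at h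
  rw [h]
  push_cast
  ring

theorem derivX_mul (y z : LaurentSeries ℂ) :
    derivX (y * z) = y * derivX z + z * derivX y := by
  -- Write d/dx = t · (-t d/dt). The operator -t d/dt multiplies the coefficient of t^i by -i, which
  -- is additive in i, and does not enlarge the support, so all three coefficients in the Leibniz
  -- rule are sums over one antidiagonal.
  have key : ∀ u : LaurentSeries ℂ, ∃ v : LaurentSeries ℂ, v.support ⊆ u.support ∧
      (∀ i, v.coeff i = -(i : ℂ) * u.coeff i) ∧ derivX u = HahnSeries.single 1 1 * v := by
    intro u
    have hc : ∀ i, (HahnSeries.single (-1 : ℤ) (1 : ℂ) * derivX u).coeff i =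
        -(i : ℂ) * u.coeff i := by
      intro i
      rw [HahnSeries.coeff_single_mul, one_mul, sub_neg_eq_add, coeff_derivX]
      push_cast
      simp
    refine ⟨HahnSeries.single (-1) 1 * derivX u, fun i hi => ?_, hc, ?_⟩
    · rw [HahnSeries.mem_support, hc] at hi
      exact right_ne_zero_of_mul hi
    · rw [← mul_assoc, HahnSeries.single_mul_single]
      simp
  obtain ⟨y', hys, hyc, hy⟩ := key y
  obtain ⟨z', hzs, hzc, hz⟩ := key z
  obtain ⟨w', -, hwc, hw⟩ := key (y * z)
  rw [hw, hy, hz, mul_left_comm y, mul_left_comm z, ← mul_add, mul_comm z]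
  congr 1
  ext i
  rw [hwc, HahnSeries.coeff_add, HahnSeries.coeff_mul, HahnSeries.coeff_mul_right'
    z.isPWO_support hzs, HahnSeries.coeff_mul_left' y.isPWO_support hys, Finset.mul_sum,
    ← Finset.sum_add_distrib]
  refine Finset.sum_congr rfl fun ij hij => ?_
  rw [Finset.mem_antidiagonal] at hij
  rw [hyc, hzc, ← hij.2.2]
  push_cast
  ring

theorem ordLE_ofPoly_of_natDegree_le {p : ℂ[X]} {d : ℕ} (h : p.natDegree ≤ d) :
    OrdLE (ofPoly p) d := fun i hi => by
  obtain ⟨j, rfl⟩ := Int.eq_ofNat_of_zero_le (show 0 ≤ i by omega)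
  rw [coeffX_ofPoly, coeff_eq_zero_of_natDegree_lt (by omega)]

theorem coeffX_ofPoly_of_neg (p : ℂ[X]) {i : ℤ} (hi : i < 0) : coeffX (ofPoly p) i = 0 := by
  rw [ofPoly, coeffX, coe_eval₂RingHom, eval₂_eq_sum_range, HahnSeries.coeff_sum]
  refine Finset.sum_eq_zero fun b _ => ?_
  have h : -i ≠ -(b : ℤ) := by omega
  simp [HahnSeries.coeff_single_of_ne h]

theorem natDegree_le_of_ordLE {p : ℂ[X]} {d : ℕ} (h : OrdLE (ofPoly p) d) : p.natDegree ≤ d :=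
  natDegree_le_iff_coeff_eq_zero.mpr fun i hi => by
    rw [← coeffX_ofPoly, h _ (by exact_mod_cast hi)]

theorem ofPoly_injective : Function.Injective ofPoly := fun p r h => by
  ext i
  rw [← coeffX_ofPoly, ← coeffX_ofPoly, h]

theorem derivX_ofPoly (p : ℂ[X]) : derivX (ofPoly p) = ofPoly (derivative p) := by
  refine ext_coeffX fun i => ?_
  rw [show i = i + 1 - 1 by ring, coeffX_derivX]
  rcases lt_or_ge i 0 with hi | hi
  · rw [show i + 1 - 1 = i by ring, coeffX_ofPoly_of_neg _ hi]
    rcases (show i + 1 ≤ 0 by omega).eq_or_lt with h | h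
    · simp [h]
    · rw [coeffX_ofPoly_of_neg _ h, mul_zero]
  · obtain ⟨j, rfl⟩ := Int.eq_ofNat_of_zero_le hi
    rw [show (j : ℤ) + 1 - 1 = j by ring, coeffX_ofPoly, coeff_derivative,
      show (j : ℤ) + 1 = ((j + 1 : ℕ) : ℤ) by push_cast; rfl, coeffX_ofPoly]
    push_cast
    ring

/-! ### Dominant balances and principal parts -/

/-- The result of substituting the polynomial `r` into `y y_x + f y + g`. -/
def residual (f g r : ℂ[X]) : ℂ[X] := r * derivative r + f * r + g

/-- `a x ^ d` is a dominant balance of `y y_x + f y + g = 0`: it cancels the top power of `x`, and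
the linearization of the equation at it is invertible on every `x ^ i` with `i ≠ 0`. Here `A` is
the coefficient of `x ^ (deg f + 1)` in `a x ^ d`. -/
structure IsBalance (f g : ℂ[X]) (a : ℂ) (d : ℕ) (A : ℂ) : Prop where
  ne_zero : a ≠ 0
  one_le : 1 ≤ d
  le_succ : d ≤ f.natDegree + 1
  coeff_eq : ∀ r : ℂ[X], r.natDegree ≤ d → r.coeff d = a → r.coeff (f.natDegree + 1) = A
  linear_ne : ∀ i : ℤ, i ≠ 0 → f.leadingCoeff + ((f.natDegree : ℂ) + 1 + i) * A ≠ 0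
  base : (residual f g (monomial d a)).natDegree ≤ f.natDegree + d - 1

theorem natDegree_le_pred_of_coeff {R : Type*} [Semiring R] {p : R[X]} {d : ℕ} (h : p.natDegree ≤ d)
    (h0 : p.coeff d = 0) : p.natDegree ≤ d - 1 := by
  refine natDegree_le_iff_coeff_eq_zero.mpr fun i hi => ?_
  rcases (show d ≤ i by omega).eq_or_lt with rfl | hlt
  · exact h0
  · exact coeff_eq_zero_of_natDegree_lt (h.trans_lt hlt)

theorem residual_sub (f g r₁ r₂ : ℂ[X]) : residual f g r₁ - residual f g r₂ =
    (r₁ - r₂) * derivative r₁ + r₂ * derivative (r₁ - r₂) + f * (r₁ - r₂) := by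
  simp only [residual, derivative_sub]
  ring

theorem natDegree_derivative_le_of_le {R : Type*} [Semiring R] {p : R[X]} {d : ℕ}
    (h : p.natDegree ≤ d + 1) : (derivative p).natDegree ≤ d := by
  have := natDegree_derivative_le p
  omega

/-- This computes the linearization of the equation: at degree m + i only the top term of r₁ - r₂
and the coefficients of `x ^ (m + 1)` in r₁ and r₂ contribute. -/
theorem residual_sub_top {f g r₁ r₂ : ℂ[X]} {i : ℕ} (hi : 1 ≤ i)
    (h₁ : r₁.natDegree ≤ f.natDegree + 1) (h₂ : r₂.natDegree ≤ f.natDegree + 1)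
    (hs : (r₁ - r₂).natDegree ≤ i) :
    (residual f g r₁ - residual f g r₂).natDegree ≤ f.natDegree + i ∧
    (residual f g r₁ - residual f g r₂).coeff (f.natDegree + i) =
      (r₁ - r₂).coeff i * (f.leadingCoeff + ((f.natDegree : ℂ) + 1) * r₁.coeff (f.natDegree + 1)
        + i * r₂.coeff (f.natDegree + 1)) := by
  obtain ⟨j, rfl⟩ := Nat.exists_eq_add_of_le' hi
  rw [residual_sub]
  have hd₁ := natDegree_derivative_le_of_le h₁
  have hds := natDegree_derivative_le_of_le hs
  constructor
  · refine natDegree_add_le_of_degree_le (natDegree_add_le_of_degree_le ?_ ?_) ?_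
    · exact (natDegree_mul_le_of_le hs hd₁).trans (by omega)
    · exact (natDegree_mul_le_of_le h₂ hds).trans (by omega)
    · exact (natDegree_mul_le_of_le le_rfl hs).trans (by omega)
  · rw [coeff_add, coeff_add, add_comm f.natDegree, coeff_mul_add_eq_of_natDegree_le hs hd₁,
      add_comm (j + 1), coeff_mul_add_eq_of_natDegree_le le_rfl hs,
      show f.natDegree + (j + 1) = (f.natDegree + 1) + j by ring,
      coeff_mul_add_eq_of_natDegree_le h₂ hds, coeff_derivative, coeff_derivative, leadingCoeff]
    push_cast
    ring

namespace IsBalance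

variable {f g : ℂ[X]} {a A : ℂ} {d : ℕ}

theorem exists_principalPart (h : IsBalance f g a d A) : ∃ r, IsPrincipalPart f g a d r := by
  -- After k corrections, in degrees d - 1, ..., d - k, the residual has degree at most m + (d - 1 -
  -- k). The case k = d - 1 is the claim, and the constant term is never touched.
  have key : ∀ k, k + 1 ≤ d → ∃ r : ℂ[X], r.natDegree ≤ d ∧ r.coeff d = a ∧ r.coeff 0 = 0 ∧
      (residual f g r).natDegree ≤ f.natDegree + (d - 1 - k) := by
    intro k
    induction k with
    | zero =>
      intro hk
      refine ⟨monomial d a, natDegree_monomial_le a, coeff_monomial_same d a,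
        coeff_monomial_of_ne a (by omega), h.base.trans (by omega)⟩
    | succ k ih =>
      intro hk
      obtain ⟨r, hr, hrd, hr0, hres⟩ := ih (by omega)
      obtain ⟨i, hi⟩ : ∃ i, i = d - 1 - k := ⟨_, rfl⟩
      rw [← hi] at hres
      have hδ := h.linear_ne i (by omega)
      -- The unique β for which β x^i cancels the coefficient of `x ^ (m + i)` in the residual;
      -- `linear_ne` applies because i ≥ 1.
      set β := -(residual f g r).coeff (f.natDegree + i) /
        (f.leadingCoeff + ((f.natDegree : ℂ) + 1 + (i : ℤ)) * A) with hβ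
      have hm : (monomial i β).natDegree ≤ i := natDegree_monomial_le β
      have hs : r + monomial i β - r = monomial i β := add_sub_cancel_left _ _
      have h₁ : (r + monomial i β).natDegree ≤ d :=
        natDegree_add_le_of_degree_le hr (hm.trans (by omega))
      have h₁d : (r + monomial i β).coeff d = a := by
        rw [coeff_add, hrd, coeff_monomial_of_ne β (by omega), add_zero]
      refine ⟨r + monomial i β, h₁, h₁d, ?_, ?_⟩
      · rw [coeff_add, hr0, coeff_monomial_of_ne β (by omega), add_zero]
      · have htop := residual_sub_top (f := f) (g := g) (i := i) (by omega)
          (h₁.trans h.le_succ) (hr.trans h.le_succ) (by rw [hs]; exact hm)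
        rw [hs, coeff_monomial_same, h.coeff_eq _ h₁ h₁d, h.coeff_eq _ hr hrd] at htop
        refine (natDegree_le_pred_of_coeff (d := f.natDegree + i) ?_ ?_).trans (by omega)
        · rw [← sub_add_cancel (residual f g (r + monomial i β)) (residual f g r)]
          exact natDegree_add_le_of_degree_le htop.1 hres
        · have h2 := htop.2
          rw [coeff_sub, sub_eq_iff_eq_add] at h2
          rw [h2]
          have h3 : β * (f.leadingCoeff + ((f.natDegree : ℂ) + 1 + (i : ℤ)) * A) =
              -(residual f g r).coeff (f.natDegree + i) := by
            rw [hβ]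
            field_simp
          rw [Int.cast_natCast] at h3
          linear_combination h3
  obtain ⟨r, hr, hrd, hr0, hres⟩ := key (d - 1) (by have := h.one_le; omega)
  have hdeg : r.natDegree = d := natDegree_eq_of_le_of_coeff_ne_zero hr (by
    rw [hrd]
    exact h.ne_zero)
  refine ⟨r, hdeg, ?_, hr0, ?_⟩
  · rw [leadingCoeff, hdeg, hrd]
  · simpa [residual] using hres

/-- Both constant terms vanish, so a nonzero difference has top degree i ≥ 1. It would then leave a
nonzero coefficient at `x ^ (m + i)` in the difference of two residuals of degree at most m. -/
theorem principalPart_unique (h : IsBalance f g a d A) {r₁ r₂ : ℂ[X]}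
    (h₁ : IsPrincipalPart f g a d r₁) (h₂ : IsPrincipalPart f g a d r₂) : r₁ = r₂ := by
  by_contra hne
  have hs : r₁ - r₂ ≠ 0 := sub_ne_zero.mpr hne
  have hc₁ : r₁.coeff d = a := by rw [← h₁.leadingCoeff_eq, leadingCoeff, h₁.natDegree_eq]
  have hc₂ : r₂.coeff d = a := by rw [← h₂.leadingCoeff_eq, leadingCoeff, h₂.natDegree_eq]
  have hi : 1 ≤ (r₁ - r₂).natDegree := by
    by_contra hlt
    have h0 : (r₁ - r₂).natDegree = 0 := by omega
    apply hs
    rw [eq_C_of_natDegree_eq_zero h0, coeff_sub, h₁.coeff_zero_eq, h₂.coeff_zero_eq, sub_zero, C_0]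
  have htop := (residual_sub_top (f := f) (g := g) hi (h₁.natDegree_eq.le.trans h.le_succ)
    (h₂.natDegree_eq.le.trans h.le_succ) le_rfl).2
  have e₁ : (residual f g r₁).natDegree ≤ f.natDegree := h₁.residual
  have e₂ : (residual f g r₂).natDegree ≤ f.natDegree := h₂.residual
  rw [coeff_sub, coeff_eq_zero_of_natDegree_lt (by omega),
    coeff_eq_zero_of_natDegree_lt (by omega), h.coeff_eq _ h₁.natDegree_eq.le hc₁,
    h.coeff_eq _ h₂.natDegree_eq.le hc₂, sub_zero] at htop
  have hδ := h.linear_ne (r₁ - r₂).natDegree (by omega)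
  rw [Int.cast_natCast] at hδ
  refine mul_ne_zero (leadingCoeff_ne_zero.mpr hs) hδ ?_
  rw [leadingCoeff]
  linear_combination -htop

end IsBalance

/-- The terms y y_x and f y cancel at degree 2m + 1, which g does not reach. The linearization at
x^i is i times the leading coefficient, so i = 0 is the only resonance. -/
theorem isBalance_I {f g : ℂ[X]} (hfg : f.natDegree < g.natDegree)
    (hgf : g.natDegree < 2 * f.natDegree + 1) :
    IsBalance f g (leadI f) (f.natDegree + 1) (leadI f) := by
  have hf : f ≠ 0 := by
    rintro rfl
    simp at hgf
    omega
  have hf0 : f.leadingCoeff ≠ 0 := leadingCoeff_ne_zero.mpr hf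
  have hm : ((f.natDegree : ℂ) + 1) ≠ 0 := Nat.cast_add_one_ne_zero _
  have ha : leadI f ≠ 0 := div_ne_zero (neg_ne_zero.mpr hf0) hm
  have hlin : f.leadingCoeff = -((f.natDegree : ℂ) + 1) * leadI f := by
    rw [leadI]
    field_simp
  refine ⟨ha, by omega, le_rfl, fun r _ hr => hr, fun i hi => ?_, ?_⟩
  · have : f.leadingCoeff + ((f.natDegree : ℂ) + 1 + i) * leadI f = i * leadI f := by
      rw [hlin]
      ring
    rw [this]
    exact mul_ne_zero (Int.cast_ne_zero.mpr hi) ha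
  · have h1 := natDegree_monomial_le (R := ℂ) (leadI f) (m := f.natDegree + 1)
    have h2 := natDegree_derivative_le_of_le h1
    refine natDegree_le_pred_of_coeff (d := f.natDegree + (f.natDegree + 1)) ?_ ?_
    · refine natDegree_add_le_of_degree_le (natDegree_add_le_of_degree_le ?_ ?_) ?_
      · exact (natDegree_mul_le_of_le h1 h2).trans (by omega)
      · exact natDegree_mul_le_of_le le_rfl h1
      · omega
    · rw [residual, coeff_add, coeff_add, coeff_mul_add_eq_of_natDegree_le le_rfl h1,
        add_comm f.natDegree (f.natDegree + 1), coeff_mul_add_eq_of_natDegree_le h1 h2,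
        coeff_derivative, coeff_monomial_same,
        coeff_eq_zero_of_natDegree_lt (p := g) (by omega), coeff_natDegree,
        hlin]
      ring

/-- The terms f y and g cancel at degree n, while y y_x has degree 2(n - m) - 1 < n because n < 2m +
1. The same inequality gives n - m ≤ m, hence A = 0, and the linearization is f₀ for every i. -/
theorem isBalance_II {f g : ℂ[X]} (hfg : f.natDegree < g.natDegree)
    (hgf : g.natDegree < 2 * f.natDegree + 1) :
    IsBalance f g (leadII f g) (g.natDegree - f.natDegree) 0 := by
  have hf : f ≠ 0 := by
    rintro rfl
    simp at hgf
    omega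
  have hg : g ≠ 0 := by
    rintro rfl
    simp at hfg
  have hf0 : f.leadingCoeff ≠ 0 := leadingCoeff_ne_zero.mpr hf
  have hg0 : g.leadingCoeff ≠ 0 := leadingCoeff_ne_zero.mpr hg
  have ha : leadII f g ≠ 0 := div_ne_zero (neg_ne_zero.mpr hg0) hf0
  refine ⟨ha, by omega, by omega, fun r hr _ => coeff_eq_zero_of_natDegree_lt (by omega),
    fun i _ => by simpa using hf0, ?_⟩
  obtain ⟨d, hd⟩ : ∃ d, g.natDegree - f.natDegree = d + 1 :=
    ⟨g.natDegree - f.natDegree - 1, by omega⟩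
  rw [hd]
  have h1 := natDegree_monomial_le (R := ℂ) (leadII f g) (m := d + 1)
  have h2 := natDegree_derivative_le_of_le h1
  have h3 := natDegree_mul_le_of_le h1 h2
  refine natDegree_le_pred_of_coeff (d := f.natDegree + (d + 1)) ?_ ?_
  · refine natDegree_add_le_of_degree_le (natDegree_add_le_of_degree_le ?_ ?_) ?_
    · exact h3.trans (by omega)
    · exact natDegree_mul_le_of_le le_rfl h1
    · omega
  · rw [residual, coeff_add, coeff_add, coeff_mul_add_eq_of_natDegree_le le_rfl h1,
      coeff_eq_zero_of_natDegree_lt (h3.trans_lt (by omega)), coeff_monomial_same, coeff_natDegree,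
      show f.natDegree + (d + 1) = g.natDegree by omega, coeff_natDegree, leadII]
    field_simp
    ring

/-! ### The recursion for the coefficients of the series -/

/-- The power series `x ^ (-d) * P(x)` in `x⁻¹`, for a polynomial `P` of degree at most `d`. -/
def revSeries (d : ℕ) (P : ℂ[X]) : PowerSeries ℂ :=
  PowerSeries.mk fun l => if l ≤ d then P.coeff (d - l) else 0

theorem single_mul_ofPoly {P : ℂ[X]} {d : ℕ} (h : P.natDegree ≤ d) :
    HahnSeries.single (d : ℤ) 1 * ofPoly P = HahnSeries.ofPowerSeries ℤ ℂ (revSeries d P) := by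
  refine ext_coeffX fun i => ?_
  rw [coeffX_single_mul]
  rcases lt_or_ge 0 i with hi | hi
  · rw [ordLE_ofPowerSeries _ _ hi, ordLE_ofPoly_of_natDegree_le h _ (by omega)]
  · obtain ⟨l, hl⟩ := Int.eq_ofNat_of_zero_le (show 0 ≤ -i by omega)
    rw [show i = -(l : ℤ) by omega, coeffX_ofPowerSeries_neg, revSeries, PowerSeries.coeff_mk]
    split_ifs with hld
    · rw [show -(l : ℤ) + d = ((d - l : ℕ) : ℤ) by omega, coeffX_ofPoly]
    · exact coeffX_ofPoly_of_neg _ (by omega)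

theorem derivX_tail (c : ℕ → ℂ) : derivX (tail c) =
    -(HahnSeries.single 1 1 * HahnSeries.ofPowerSeries ℤ ℂ (PowerSeries.mk fun l => l * c l)) := by
  refine ext_coeffX fun i => ?_
  rw [show i = i + 1 - 1 by ring, coeffX_derivX, coeffX_neg, coeffX_single_mul,
    show i + 1 - 1 + 1 = i + 1 by ring]
  rcases lt_or_ge 0 (i + 1) with hi | hi
  · rw [ordLE_tail _ _ hi, ordLE_ofPowerSeries _ _ hi]
    simp
  · obtain ⟨l, hl⟩ := Int.eq_ofNat_of_zero_le (show 0 ≤ -(i + 1) by omega)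
    rw [show i + 1 = -(l : ℤ) by omega, coeffX_tail_neg, coeffX_ofPowerSeries_neg,
      PowerSeries.coeff_mk]
    push_cast
    ring

/-- The coefficient of `t ^ l` in `ρ + φ w - κ θ(w) - t ^ (m + 1) w θ(w)`, where `θ = t d/dt`. -/
def recursionTerm (m : ℕ) (ρ φ κ : PowerSeries ℂ) {R : Type*} [CommRing R] [Algebra ℂ R]
    (w : ℕ → R) (l : ℕ) : R :=
  algebraMap ℂ R (PowerSeries.coeff l ρ) +
    ∑ x ∈ Finset.HasAntidiagonal.antidiagonal l,
      algebraMap ℂ R (PowerSeries.coeff x.1 φ - x.2 * PowerSeries.coeff x.1 κ) * w x.2 -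
    if m + 1 ≤ l then
      ∑ x ∈ Finset.HasAntidiagonal.antidiagonal (l - (m + 1)), w x.1 * ((x.2 : R) * w x.2) else 0

theorem coeff_recursion (m : ℕ) (ρ φ κ : PowerSeries ℂ) (c : ℕ → ℂ) (l : ℕ) :
    PowerSeries.coeff l (ρ + φ * PowerSeries.mk c - κ * PowerSeries.mk (fun l => l * c l) -
      PowerSeries.X ^ (m + 1) * (PowerSeries.mk c * PowerSeries.mk fun l => l * c l)) =
    recursionTerm m ρ φ κ c l := by
  rw [map_sub, PowerSeries.coeff_X_pow_mul']
  simp only [recursionTerm, map_sub, map_add, PowerSeries.coeff_mul, PowerSeries.coeff_mk,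
    Algebra.algebraMap_self, RingHom.id_apply]
  rw [add_sub_assoc (PowerSeries.coeff l ρ), ← Finset.sum_sub_distrib]
  congr 2
  refine Finset.sum_congr rfl fun x _ => ?_
  ring

/-- The recursion is stated over any ℂ-algebra so that one formula serves the universal coefficients
in `ℂ[X]` and, through `aeval`, their values at a given first coefficient. -/
theorem map_recursionTerm (m : ℕ) (ρ φ κ : PowerSeries ℂ) {R S : Type*} [CommRing R] [Algebra ℂ R]
    [CommRing S] [Algebra ℂ S] (h : R →ₐ[ℂ] S) (w : ℕ → R) (l : ℕ) :
    h (recursionTerm m ρ φ κ w l) = recursionTerm m ρ φ κ (fun j => h (w j)) l := by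
  simp only [recursionTerm, map_add, map_sub, map_sum, map_mul, apply_ite h, map_zero, map_natCast,
    AlgHom.commutes]

/-- The quadratic part carries the factor t^(m + 1) and involves only indices at most l. The unknown
of index l + 1 therefore enters linearly, with a factor built from the constant terms of φ and κ. -/
theorem recursionTerm_succ (m : ℕ) (ρ φ κ : PowerSeries ℂ) {R : Type*} [CommRing R] [Algebra ℂ R]
    (w v : ℕ → R) (l : ℕ) (hv : ∀ j ≤ l, v j = w j) (hv' : v (l + 1) = 0) :
    recursionTerm m ρ φ κ w (l + 1) =
      algebraMap ℂ R (PowerSeries.coeff 0 φ - (l + 1 : ℕ) * PowerSeries.coeff 0 κ) * w (l + 1) +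
      recursionTerm m ρ φ κ v (l + 1) := by
  have h1 : ∀ x ∈ Finset.HasAntidiagonal.antidiagonal l, v x.2 = w x.2 := fun x hx =>
    hv _ (by have := Finset.HasAntidiagonal.mem_antidiagonal.mp hx; omega)
  have h2 : ∀ x ∈ Finset.HasAntidiagonal.antidiagonal (l + 1 - (m + 1)),
      w x.1 * ((x.2 : R) * w x.2) = v x.1 * ((x.2 : R) * v x.2) := fun x hx => by
    have := Finset.HasAntidiagonal.mem_antidiagonal.mp hx
    rw [hv x.1 (by omega), hv x.2 (by omega)]
  rw [recursionTerm, recursionTerm, Finset.sum_congr rfl h2]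
  simp only [Finset.Nat.sum_antidiagonal_succ, hv', mul_zero, zero_add]
  rw [Finset.sum_congr rfl fun x hx => by rw [← h1 x hx]]
  ring

/-- The coefficients of a solution of the recursion as polynomials in the first of them. -/
def coeffPoly (m : ℕ) (ρ φ κ : PowerSeries ℂ) : ℕ → ℂ[X]
  | 0 => X
  | l + 1 => C (-(PowerSeries.coeff 0 φ - (l + 1 : ℕ) * PowerSeries.coeff 0 κ)⁻¹) *
      recursionTerm m ρ φ κ (fun j => if _ : j < l + 1 then coeffPoly m ρ φ κ j else 0) (l + 1)

theorem recursion_iff {m : ℕ} {ρ φ κ : PowerSeries ℂ}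
    (h : ∀ l : ℕ, PowerSeries.coeff 0 φ - (l + 1 : ℕ) * PowerSeries.coeff 0 κ ≠ 0) (c : ℕ → ℂ) :
    (∀ l, recursionTerm m ρ φ κ c (l + 1) = 0) ↔
      ∀ l, c l = (coeffPoly m ρ φ κ l).eval (c 0) := by
  have key : ∀ l, (∀ j ≤ l, c j = (coeffPoly m ρ φ κ j).eval (c 0)) →
      (recursionTerm m ρ φ κ c (l + 1) = 0 ↔
        c (l + 1) = (coeffPoly m ρ φ κ (l + 1)).eval (c 0)) := by
    intro l hl
    have hv : ∀ j, (aeval (c 0))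
        (if _ : j < l + 1 then coeffPoly m ρ φ κ j else 0) = if j < l + 1 then c j else 0 := by
      intro j
      split_ifs with hj
      · rw [hl j (by omega), coe_aeval_eq_eval]
      · simp
    have hE : (coeffPoly m ρ φ κ (l + 1)).eval (c 0) =
        -(PowerSeries.coeff 0 φ - (l + 1 : ℕ) * PowerSeries.coeff 0 κ)⁻¹ *
          recursionTerm m ρ φ κ (fun j => if j < l + 1 then c j else 0) (l + 1) := by
      rw [coeffPoly, eval_mul, eval_C, ← coe_aeval_eq_eval, map_recursionTerm]
      simp only [hv]
    rw [hE, recursionTerm_succ m ρ φ κ c (fun j => if j < l + 1 then c j else 0) l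
      (fun j hj => if_pos (by omega)) (if_neg (by omega)), Algebra.algebraMap_self,
      RingHom.id_apply]
    have := h l
    constructor
    · intro h0
      field_simp
      linear_combination h0
    · intro h0
      rw [h0]
      field_simp
      ring
  constructor
  · intro h0 l
    induction l using Nat.strong_induction_on with
    | _ l ih =>
      cases l with
      | zero => simp [coeffPoly]
      | succ l => exact (key l fun j hj => ih j (by omega)).mp (h0 l)
  · intro h0 l
    exact (key l fun j _ => h0 j).mpr (h0 _)

/-! ### Series with a given principal part -/

theorem solution_expand (f g r : ℂ[X]) (w : LaurentSeries ℂ) :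
    (ofPoly r + w) * derivX (ofPoly r + w) + ofPoly f * (ofPoly r + w) + ofPoly g =
      ofPoly (residual f g r) + ofPoly (f + derivative r) * w + ofPoly r * derivX w
        + w * derivX w := by
  rw [derivX_add, derivX_ofPoly, residual]
  simp only [map_add, map_mul]
  ring

/-- The recursion satisfied by the coefficients of the solutions with principal part `r`. -/
def seriesTerm (f g r : ℂ[X]) (c : ℕ → ℂ) (l : ℕ) : ℂ :=
  recursionTerm f.natDegree (revSeries f.natDegree (residual f g r))
    (revSeries f.natDegree (f + derivative r)) (revSeries (f.natDegree + 1) r) c l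

/-- The coefficients of the solutions with principal part `r` as polynomials in the first one. -/
def seriesPoly (f g r : ℂ[X]) : ℕ → ℂ[X] :=
  coeffPoly f.natDegree (revSeries f.natDegree (residual f g r))
    (revSeries f.natDegree (f + derivative r)) (revSeries (f.natDegree + 1) r)

/-- Multiplying the equation by t^m turns every term into a power series in t, since d/dx = -t θ
with θ = t d/dt; the recursion is the list of its coefficients. -/
theorem isSolution_iff {f g r : ℂ[X]} (hr : r.natDegree ≤ f.natDegree + 1)
    (hres : (residual f g r).natDegree ≤ f.natDegree) (c : ℕ → ℂ) :
    IsSolution f g (ofPoly r + tail c) ↔ ∀ l, seriesTerm f g r c l = 0 := by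
  have hφ : (f + derivative r).natDegree ≤ f.natDegree :=
    natDegree_add_le_of_degree_le le_rfl (natDegree_derivative_le_of_le hr)
  have hm : (HahnSeries.single (f.natDegree : ℤ) (1 : ℂ)) ≠ 0 := by simp
  have h2 : HahnSeries.single (f.natDegree : ℤ) (1 : ℂ) * HahnSeries.single (1 : ℤ) (1 : ℂ) =
      HahnSeries.single ((f.natDegree + 1 : ℕ) : ℤ) (1 : ℂ) := by
    rw [HahnSeries.single_mul_single]
    simp
  have key : HahnSeries.single (f.natDegree : ℤ) (1 : ℂ) *
      ((ofPoly r + tail c) * derivX (ofPoly r + tail c) + ofPoly f * (ofPoly r + tail c)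
        + ofPoly g) = HahnSeries.ofPowerSeries ℤ ℂ
      (revSeries f.natDegree (residual f g r) +
        revSeries f.natDegree (f + derivative r) * PowerSeries.mk c -
        revSeries (f.natDegree + 1) r * PowerSeries.mk (fun l => l * c l) -
        PowerSeries.X ^ (f.natDegree + 1) *
          (PowerSeries.mk c * PowerSeries.mk fun l => l * c l)) := by
    rw [solution_expand, derivX_tail]
    simp only [map_add, map_sub, (HahnSeries.ofPowerSeries ℤ ℂ).map_mul,
      HahnSeries.ofPowerSeries_X_pow, ← single_mul_ofPoly hr, ← single_mul_ofPoly hres,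
      ← single_mul_ofPoly hφ, ← h2, tail]
    ring
  rw [IsSolution, ← mul_eq_zero_iff_left hm, key,
    map_eq_zero_iff _ HahnSeries.ofPowerSeries_injective,
    PowerSeries.ext_iff]
  simp only [coeff_recursion, map_zero]
  rfl

theorem coeff_zero_revSeries (d : ℕ) (P : ℂ[X]) :
    PowerSeries.coeff 0 (revSeries d P) = P.coeff d := by
  simp [revSeries]

theorem seriesTerm_zero (f g r : ℂ[X]) (c : ℕ → ℂ) : seriesTerm f g r c 0 =
    (residual f g r).coeff f.natDegree + (f + derivative r).coeff f.natDegree * c 0 := by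
  simp [seriesTerm, recursionTerm, revSeries]

theorem exists_tail_of_ordLE {w : LaurentSeries ℂ} (hw : OrdLE w 0) : ∃ c, w = tail c := by
  obtain ⟨P, hP⟩ := hw.exists_powerSeries
  refine ⟨fun l => PowerSeries.coeff l P, ?_⟩
  rw [hP, neg_zero, show (HahnSeries.single (0 : ℤ) (1 : ℂ)) = 1 from rfl, one_mul, tail]
  congr 1
  ext l
  simp

namespace IsBalance

variable {f g : ℂ[X]} {a A : ℂ} {d : ℕ} {r : ℂ[X]}

theorem coeff_eq_of_principalPart (h : IsBalance f g a d A) (hr : IsPrincipalPart f g a d r) :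
    r.coeff (f.natDegree + 1) = A :=
  h.coeff_eq r hr.natDegree_eq.le (by rw [← hr.leadingCoeff_eq, leadingCoeff, hr.natDegree_eq])

theorem natDegree_le (h : IsBalance f g a d A) (hr : IsPrincipalPart f g a d r) :
    r.natDegree ≤ f.natDegree + 1 := hr.natDegree_eq.le.trans h.le_succ

theorem coeff_linear (h : IsBalance f g a d A) (hr : IsPrincipalPart f g a d r) :
    (f + derivative r).coeff f.natDegree = f.leadingCoeff + ((f.natDegree : ℂ) + 1) * A := by
  rw [coeff_add, coeff_derivative, h.coeff_eq_of_principalPart hr, coeff_natDegree]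
  ring

/-- The equation of index 0 stands apart because its linear factor may vanish: for type (II) it
determines `c 0`, for type (I) it is a condition on f and g alone. -/
theorem isSolution_iff (h : IsBalance f g a d A) (hr : IsPrincipalPart f g a d r) (c : ℕ → ℂ) :
    IsSolution f g (ofPoly r + tail c) ↔
      (residual f g r).coeff f.natDegree +
        (f.leadingCoeff + ((f.natDegree : ℂ) + 1) * A) * c 0 = 0 ∧
      ∀ l, c l = (seriesPoly f g r l).eval (c 0) := by
  rw [Lienard.isSolution_iff (h.natDegree_le hr) hr.residual, ← h.coeff_linear hr,
    ← seriesTerm_zero, seriesPoly, ← recursion_iff]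
  · constructor
    · exact fun h0 => ⟨h0 0, fun l => h0 (l + 1)⟩
    · rintro ⟨h0, h1⟩ (_ | l)
      exacts [h0, h1 l]
  · intro l
    rw [coeff_zero_revSeries, coeff_zero_revSeries, h.coeff_linear hr,
      h.coeff_eq_of_principalPart hr]
    -- The coefficient of index l + 1 multiplies x^(-(l + 1)), so the linearization is taken at this
    -- negative exponent.
    have := h.linear_ne (-(l + 1 : ℕ)) (by omega)
    intro h0
    apply this
    push_cast at h0 ⊢
    linear_combination h0

theorem exists_eq_add_tail (h : IsBalance f g a d A) (hr : IsPrincipalPart f g a d r)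
    {y : LaurentSeries ℂ} (hy : IsSolution f g y) (hlead : HasLeadingTerm y a d) :
    ∃ c, y = ofPoly r + tail c := by
  -- The constant term goes into the tail, so that s has the normalization of a principal part. With
  -- w the tail, s has residual -((f + s_x) w + s w_x + w w_x), of order at most m, and uniqueness
  -- identifies s with r.
  set s : ℂ[X] := polyPartX y - C (coeffX y 0) with hs
  have hsc : ∀ i : ℕ, i ≠ 0 → s.coeff i = coeffX y i := by
    intro i hi
    rw [hs, coeff_sub, coeff_polyPartX, coeff_C_of_ne_zero hi, sub_zero]
  have hw : OrdLE (y - ofPoly s) 0 := by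
    intro i hi
    obtain ⟨j, rfl⟩ := Int.eq_ofNat_of_zero_le hi.le
    rw [coeffX_sub, coeffX_ofPoly, hsc j (by omega), sub_self]
  obtain ⟨c, hc⟩ := exists_tail_of_ordLE hw
  have hyc : y = ofPoly s + tail c := by rw [← hc]; ring
  have hd := h.one_le
  have hdeg : s.natDegree ≤ d := natDegree_le_iff_coeff_eq_zero.mpr fun i hi => by
    rw [hsc i (by omega)]
    exact hlead.2.2 _ (by exact_mod_cast hi)
  have hsd : s.coeff d = a := by rw [hsc d (by omega), hlead.2.1]
  have hdeg' : s.natDegree = d := natDegree_eq_of_le_of_coeff_ne_zero hdeg (hsd ▸ h.ne_zero)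
  have hsp : IsPrincipalPart f g a d s := by
    refine ⟨hdeg', by rw [leadingCoeff, hdeg', hsd], ?_, ?_⟩
    · rw [hs, coeff_sub, coeff_polyPartX, coeff_C_zero]
      simp
    · apply natDegree_le_of_ordLE
      have hE := hy
      rw [hyc, IsSolution, solution_expand] at hE
      have hφ : (f + derivative s).natDegree ≤ f.natDegree :=
        natDegree_add_le_of_degree_le le_rfl
          (natDegree_derivative_le_of_le (hdeg.trans h.le_succ))
      have h0 := ordLE_tail c
      have h1 := (ordLE_ofPoly_of_natDegree_le hφ).mul h0
      have h2 := (ordLE_ofPoly_of_natDegree_le (hdeg.trans h.le_succ)).mul h0.derivX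
      have h3 := h0.mul h0.derivX
      have h4 := ((h1.mono (e := f.natDegree) (by omega)).add
        (h2.mono (by push_cast; omega))).add (h3.mono (by omega))
      change OrdLE (ofPoly (residual f g s)) _
      have h5 : ofPoly (residual f g s) = -(ofPoly (f + derivative s) * tail c +
          ofPoly s * derivX (tail c) + tail c * derivX (tail c)) := by
        linear_combination hE
      rw [h5]
      exact h4.neg
  rw [h.principalPart_unique hr hsp]
  exact ⟨c, hyc⟩

end IsBalance

/-! ### The vector field on polynomials over Laurent series -/

instance : IsRightCancelAdd (LaurentSeries ℂ)[X] :=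
  ⟨fun a _ _ h => Polynomial.ext fun i => add_right_cancel (b := a.coeff i)
    (by simpa only [coeff_add] using congrArg (fun W => W.coeff i) h)⟩

/-- Differentiation of the coefficients. -/
def dX (W : (LaurentSeries ℂ)[X]) : (LaurentSeries ℂ)[X] :=
  W.sum fun i a => monomial i (derivX a)

theorem coeff_dX (W : (LaurentSeries ℂ)[X]) (i : ℕ) : (dX W).coeff i = derivX (W.coeff i) := by
  simp only [dX, Polynomial.sum_def, finsetSum_coeff, coeff_monomial]
  rw [Finset.sum_ite_eq' W.support i]
  by_cases h : i ∈ W.support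
  · simp [h]
  · simp [notMem_support_iff.mp h]

theorem dX_add (V W : (LaurentSeries ℂ)[X]) : dX (V + W) = dX V + dX W := by
  ext1 i
  simp only [coeff_dX, coeff_add, derivX_add]

/-- `derivX` as an additive map. -/
def derivXHom : LaurentSeries ℂ →+ LaurentSeries ℂ where
  toFun := derivX
  map_zero' := derivX_zero
  map_add' := derivX_add

theorem derivX_sum {ι : Type*} (s : Finset ι) (y : ι → LaurentSeries ℂ) :
    derivX (∑ i ∈ s, y i) = ∑ i ∈ s, derivX (y i) := map_sum derivXHom y s

theorem dX_mul (V W : (LaurentSeries ℂ)[X]) : dX (V * W) = V * dX W + W * dX V := by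
  ext1 i
  rw [mul_comm W, coeff_dX, coeff_add, coeff_mul, coeff_mul, coeff_mul, derivX_sum,
    ← Finset.sum_add_distrib]
  refine Finset.sum_congr rfl fun x _ => ?_
  rw [derivX_mul, coeff_dX, coeff_dX]
  ring

theorem derivX_one : derivX 1 = 0 := by
  have h := derivX_ofPoly 1
  rwa [map_one, derivative_one, map_zero] at h

theorem dX_C (a : LaurentSeries ℂ) : dX (C a) = C (derivX a) := by
  ext1 i
  rw [coeff_dX, coeff_C, coeff_C]
  split_ifs <;> simp

theorem dX_X : dX X = 0 := by
  ext1 i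
  rw [coeff_dX, coeff_X]
  split_ifs <;> simp [derivX_one]

theorem derivX_eval (W : (LaurentSeries ℂ)[X]) (z : LaurentSeries ℂ) :
    derivX (W.eval z) = (dX W).eval z + (derivative W).eval z * derivX z := by
  induction W using Polynomial.induction_on with
  | C a => simp [dX_C]
  | add V W hV hW =>
    simp only [eval_add, derivX_add, dX_add, derivative_add, hV, hW]
    ring
  | monomial n a h =>
    rw [pow_succ, ← mul_assoc, dX_mul, dX_X, derivative_mul, derivative_X, eval_mul, eval_X,
      derivX_mul, h]
    simp only [eval_add, eval_mul, eval_X, eval_zero, eval_one]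
    ring

theorem dX_comp (W : (LaurentSeries ℂ)[X]) (s : LaurentSeries ℂ) :
    dX (W.comp (X + C s)) =
      (dX W).comp (X + C s) + C (derivX s) * (derivative W).comp (X + C s) := by
  induction W using Polynomial.induction_on with
  | C a => simp [dX_C]
  | add V W hV hW =>
    simp only [add_comp, dX_add, derivative_add, hV, hW]
    ring
  | monomial n a h =>
    rw [pow_succ, ← mul_assoc, dX_mul, dX_X, derivative_mul, derivative_X, mul_comp, X_comp,
      dX_mul, h, dX_add, dX_X, dX_C]
    simp only [add_comp, mul_comp, X_comp, zero_comp, one_comp]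
    ring

/-- The derivation of `ℂ((x⁻¹))[y]` along the Liénard vector field. -/
def vectorField (f g : ℂ[X]) (W : (LaurentSeries ℂ)[X]) : (LaurentSeries ℂ)[X] :=
  X * dX W - (C (ofPoly f) * X + C (ofPoly g)) * derivative W

variable {f g : ℂ[X]}

theorem vectorField_mul (V W : (LaurentSeries ℂ)[X]) :
    vectorField f g (V * W) = V * vectorField f g W + W * vectorField f g V := by
  simp only [vectorField, dX_mul, derivative_mul]
  ring

/-- By the chain rule, since z z_x = -(f z + g): the graph of z is invariant, and on it the field
acts as z d/dx. -/
theorem eval_vectorField {z : LaurentSeries ℂ} (hz : IsSolution f g z)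
    (W : (LaurentSeries ℂ)[X]) :
    (vectorField f g W).eval z = z * derivX (W.eval z) := by
  rw [IsSolution] at hz
  rw [derivX_eval, vectorField]
  simp only [eval_sub, eval_mul, eval_add, eval_X, eval_C]
  linear_combination -(derivative W).eval z * hz

theorem vectorField_X_sub_C {z : LaurentSeries ℂ} (hz : IsSolution f g z) :
    vectorField f g (X - C z) = -C (ofPoly f + derivX z) * (X - C z) := by
  have h1 : dX (X - C z) = -C (derivX z) := by
    have h0 : X - C z = X + C (-z) := by
      rw [C_neg]
      ring
    rw [h0, dX_add, dX_X, dX_C, derivX_neg, C_neg, zero_add]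
  have h2 : C z * C (derivX z) + C (ofPoly f) * C z + C (ofPoly g) = 0 := by
    rw [← C_mul, ← C_mul, ← C_add, ← C_add, hz, C_0]
  rw [vectorField, h1, derivative_X_sub_C, C_add]
  linear_combination -h2

/-- Eigenvalues add under products, and X - z is an eigenvector with eigenvalue -(f + z_x). -/
theorem vectorField_of_mul {z ev : LaurentSeries ℂ} (hz : IsSolution f g z)
    {V : (LaurentSeries ℂ)[X]} (h : vectorField f g ((X - C z) * V) = C ev * ((X - C z) * V)) :
    vectorField f g V = C (ev + (ofPoly f + derivX z)) * V := by
  rw [vectorField_mul, vectorField_X_sub_C hz] at h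
  apply mul_left_cancel₀ (X_sub_C_ne_zero z)
  rw [C_add (a := ev)]
  linear_combination h

/-- The vector field in the variable w = y - q. -/
theorem vectorField_comp (q : ℂ[X]) (W : (LaurentSeries ℂ)[X]) :
    (vectorField f g W).comp (X + C (ofPoly q)) =
      X * dX (W.comp (X + C (ofPoly q))) + C (ofPoly q) * dX (W.comp (X + C (ofPoly q))) -
      (C (ofPoly (residual f g q)) * derivative (W.comp (X + C (ofPoly q))) +
        C (ofPoly (f + derivative q)) * (X * derivative (W.comp (X + C (ofPoly q))))) := by
  rw [dX_comp, derivative_comp, vectorField, derivX_ofPoly, residual]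
  simp only [sub_comp, mul_comp, add_comp, X_comp, C_comp, derivative_X,
    derivative_C, map_add, map_mul]
  ring

/-! ### Invariant polynomials whose eigenvalue has small order -/

theorem coeffX_mul_natCast (y : LaurentSeries ℂ) (n : ℕ) (i : ℤ) :
    coeffX (y * (n : LaurentSeries ℂ)) i = coeffX y i * n := by
  rw [← nsmul_eq_mul', coeffX, HahnSeries.coeff_smul, nsmul_eq_mul', coeffX]

theorem coeffX_sum {ι : Type*} (s : Finset ι) (y : ι → LaurentSeries ℂ) (i : ℤ) :
    coeffX (∑ j ∈ s, y j) i = ∑ j ∈ s, coeffX (y j) i := by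
  simp only [coeffX, HahnSeries.coeff_sum]

theorem OrdLE.pow_zero {w : LaurentSeries ℂ} (hw : OrdLE w 0) (n : ℕ) :
    OrdLE (w ^ n) 0 ∧ coeffX (w ^ n) 0 = coeffX w 0 ^ n := by
  induction n with
  | zero =>
    rw [_root_.pow_zero, _root_.pow_zero, ← map_one ofPoly]
    refine ⟨ordLE_ofPoly_of_natDegree_le (by simp), ?_⟩
    simpa using coeffX_ofPoly 1 0
  | succ n ih =>
    rw [pow_succ, pow_succ, ← ih.2]
    exact ⟨ih.1.mul hw, ih.1.coeffX_mul hw⟩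

theorem eval_ordLE_zero {G : (LaurentSeries ℂ)[X]} (hG : ∀ i, OrdLE (G.coeff i) 0)
    {w : LaurentSeries ℂ} (hw : OrdLE w 0) :
    OrdLE (G.eval w) 0 ∧ coeffX (G.eval w) 0 =
      ∑ i ∈ Finset.range (G.natDegree + 1), coeffX (G.coeff i) 0 * coeffX w 0 ^ i := by
  rw [eval_eq_sum_range]
  constructor
  · intro j hj
    rw [coeffX_sum]
    exact Finset.sum_eq_zero fun i _ => ((hG i).mul (hw.pow_zero i).1) j hj
  · rw [coeffX_sum]
    refine Finset.sum_congr rfl fun i _ => ?_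
    rw [← (hw.pow_zero i).2]
    exact (hG i).coeffX_mul (hw.pow_zero i).1

/-- D is the largest order among the coefficients, and i is the last index at which it is attained.
-/
theorem exists_top_coeff {G : (LaurentSeries ℂ)[X]} (hG : G ≠ 0) :
    ∃ (D : ℤ) (i : ℕ), (∀ j, OrdLE (G.coeff j) D) ∧ coeffX (G.coeff i) D ≠ 0 ∧
      ∀ j, i < j → coeffX (G.coeff j) D = 0 := by
  obtain ⟨k, hk, hmax⟩ := Finset.exists_max_image G.support (fun i => -(G.coeff i).order)
    (support_nonempty.mpr hG)
  set D := -(G.coeff k).order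
  have hD : ∀ j, OrdLE (G.coeff j) D := by
    intro j
    by_cases hj : j ∈ G.support
    · exact (ordLE_neg_order _).mono (hmax j hj)
    · rw [notMem_support_iff.mp hj]
      exact fun _ _ => rfl
  have hkD : coeffX (G.coeff k) D ≠ 0 := by
    rw [coeffX, neg_neg]
    exact HahnSeries.coeff_order_eq_zero.not.mpr (mem_support_iff.mp hk)
  obtain ⟨i, hi, himax⟩ := Finset.exists_max_image
    (G.support.filter fun i => coeffX (G.coeff i) D ≠ 0) id ⟨k, Finset.mem_filter.mpr ⟨hk, hkD⟩⟩
  refine ⟨D, i, hD, (Finset.mem_filter.mp hi).2, fun j hj => ?_⟩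
  by_contra h
  refine absurd (himax j (Finset.mem_filter.mpr ⟨mem_support_iff.mpr fun h0 => h ?_, h⟩))
    (not_le.mpr hj)
  rw [h0, coeffX_zero]

theorem coeff_linear_I {q : ℂ[X]} (hfg : f.natDegree < g.natDegree)
    (hgf : g.natDegree < 2 * f.natDegree + 1)
    (hq : IsPrincipalPart f g (leadI f) (f.natDegree + 1) q) :
    (f + derivative q).coeff f.natDegree = 0 := by
  rw [(isBalance_I hfg hgf).coeff_linear hq, leadI]
  have hm : ((f.natDegree : ℂ) + 1) ≠ 0 := Nat.cast_add_one_ne_zero _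
  field_simp
  ring

theorem ordLE_linear_I {q : ℂ[X]} (hfg : f.natDegree < g.natDegree)
    (hgf : g.natDegree < 2 * f.natDegree + 1)
    (hq : IsPrincipalPart f g (leadI f) (f.natDegree + 1) q) :
    OrdLE (ofPoly (f + derivative q)) f.natDegree :=
  ordLE_ofPoly_of_natDegree_le (natDegree_add_le_of_degree_le le_rfl
    (natDegree_derivative_le_of_le ((isBalance_I hfg hgf).natDegree_le hq)))

/-- Compare coefficients of x^(m + D) w^i. The term w G_x has order at most D - 1, f + q_x has lost
its x^m term, and the eigenvalue has order at most m - 1; only q G_x and the residual term times G_w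
survive. -/
theorem top_coeff_recursion {q : ℂ[X]} (hfg : f.natDegree < g.natDegree)
    (hgf : g.natDegree < 2 * f.natDegree + 1)
    (hq : IsPrincipalPart f g (leadI f) (f.natDegree + 1) q)
    {G : (LaurentSeries ℂ)[X]} {ev : LaurentSeries ℂ}
    (hev : OrdLE ev (f.natDegree - 1)) {D : ℤ} (hD : ∀ j, OrdLE (G.coeff j) D)
    (hG : X * dX G + C (ofPoly q) * dX G - (C (ofPoly (residual f g q)) * derivative G +
        C (ofPoly (f + derivative q)) * (X * derivative G)) = C ev * G) (i : ℕ) :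
    leadI f * (D * coeffX (G.coeff i) D) =
      (residual f g q).coeff f.natDegree * (coeffX (G.coeff (i + 1)) D * (i + 1 : ℕ)) := by
  have h := congrArg (fun W : (LaurentSeries ℂ)[X] => coeffX (W.coeff i) (f.natDegree + D)) hG
  simp only [coeff_add, coeff_sub, coeff_C_mul, coeffX_add, coeffX_sub] at h
  have hres : OrdLE (ofPoly (residual f g q)) f.natDegree :=
    ordLE_ofPoly_of_natDegree_le hq.residual
  have hdG : ∀ j, OrdLE ((derivative G).coeff j) D := fun j k hk => by
    rw [coeff_derivative, ← Nat.cast_add_one, coeffX_mul_natCast, hD _ _ hk, zero_mul]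
  have hXdG : OrdLE ((X * derivative G).coeff i) D := by
    cases i with
    | zero =>
      rw [mul_coeff_zero, coeff_X_zero, zero_mul]
      exact fun _ _ => rfl
    | succ i => rw [coeff_X_mul]; exact hdG i
  have h1 : coeffX ((X * dX G).coeff i) (f.natDegree + D) = 0 := by
    cases i with
    | zero => simp
    | succ i =>
      rw [coeff_X_mul, coeff_dX]
      exact (hD i).derivX _ (by omega)
  have h2 : coeffX (ofPoly q * (dX G).coeff i) (f.natDegree + D) =
      leadI f * (D * coeffX (G.coeff i) D) := by
    have hq1 := ordLE_ofPoly_of_natDegree_le hq.natDegree_eq.le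
    have := hq1.coeffX_mul (hD i).derivX
    rw [coeffX_ofPoly, coeffX_derivX, ← hq.natDegree_eq, coeff_natDegree, hq.leadingCoeff_eq,
      hq.natDegree_eq] at this
    rw [coeff_dX, ← this]
    congr 1
    push_cast
    ring
  have h3 := hres.coeffX_mul (hdG i)
  rw [coeffX_ofPoly, coeff_derivative, ← Nat.cast_add_one, coeffX_mul_natCast] at h3
  have h4 := (ordLE_linear_I hfg hgf hq).coeffX_mul hXdG
  rw [coeffX_ofPoly, coeff_linear_I hfg hgf hq, zero_mul] at h4
  have h5 : coeffX (ev * G.coeff i) (f.natDegree + D) = 0 := hev.mul (hD i) _ (by omega)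
  rw [coeff_derivative, ← Nat.cast_add_one, h1, h2, h3, h4, h5] at h
  linear_combination h

/-- At the last index of maximal order D the right side of the recursion is zero, which forces D =
0. -/
theorem shift_integral {q : ℂ[X]} (hfg : f.natDegree < g.natDegree)
    (hgf : g.natDegree < 2 * f.natDegree + 1)
    (hq : IsPrincipalPart f g (leadI f) (f.natDegree + 1) q)
    {W : (LaurentSeries ℂ)[X]} (hW : W.Monic) {ev : LaurentSeries ℂ}
    (hev : OrdLE ev (f.natDegree - 1)) (h : vectorField f g W = C ev * W) :
    (∀ i, OrdLE ((W.comp (X + C (ofPoly q))).coeff i) 0) ∧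
      (W.natDegree ≠ 0 → (residual f g q).coeff f.natDegree = 0) := by
  have hG := vectorField_comp (f := f) (g := g) q W
  rw [h, mul_comp, C_comp] at hG
  have hmonic : (W.comp (X + C (ofPoly q))).Monic := hW.comp_X_add_C _
  have hdeg : (W.comp (X + C (ofPoly q))).natDegree = W.natDegree := by
    rw [natDegree_comp, natDegree_X_add_C, mul_one]
  set G := W.comp (X + C (ofPoly q))
  obtain ⟨D, i, hD, hi, hj⟩ := exists_top_coeff hmonic.ne_zero
  have hrec := fun {D} hD i => top_coeff_recursion hfg hgf hq (D := D) hev hD hG.symm i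
  have hD0 : D = 0 := by
    have h1 := hrec hD i
    rw [hj _ (Nat.lt_succ_self i), zero_mul, mul_zero] at h1
    have h2 := (mul_eq_zero.mp h1).resolve_left (isBalance_I hfg hgf).ne_zero
    exact_mod_cast (mul_eq_zero.mp h2).resolve_right hi
  subst hD0
  refine ⟨hD, fun hn => ?_⟩
  -- With D = 0, the recursion just below the top index reads 0 = ρ (M + 1), because G is monic.
  obtain ⟨M, hM⟩ := Nat.exists_eq_succ_of_ne_zero hn
  have h1 := hrec hD M
  have h2 : coeffX (G.coeff (M + 1)) 0 = 1 := by
    rw [show M + 1 = G.natDegree by omega, hmonic.coeff_natDegree, ← map_one ofPoly]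
    simpa using coeffX_ofPoly 1 0
  rw [h2, Int.cast_zero, zero_mul, mul_zero, one_mul] at h1
  exact (mul_eq_zero.mp h1.symm).resolve_right (Nat.cast_ne_zero.mpr (Nat.succ_ne_zero M))

/-- A root of the reduction modulo x⁻¹ lifts to the type (I) series with that constant term. If W
did not vanish there, ev W(y) = y (W(y))_x would force W(y) to have exact order 0, yet its
coefficient of x^0 is zero. -/
theorem exists_root {q : ℂ[X]} (hfg : f.natDegree < g.natDegree)
    (hgf : g.natDegree < 2 * f.natDegree + 1)
    (hq : IsPrincipalPart f g (leadI f) (f.natDegree + 1) q)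
    {W : (LaurentSeries ℂ)[X]} (hW : W.Monic) (hn : W.natDegree ≠ 0)
    {ev : LaurentSeries ℂ} (hev : OrdLE ev (f.natDegree - 1))
    (h : vectorField f g W = C ev * W) :
    ∃ c : ℕ → ℂ, IsSolution f g (ofPoly q + tail c) ∧
      (∀ l, c l = (seriesPoly f g q l).eval (c 0)) ∧ W.IsRoot (ofPoly q + tail c) := by
  obtain ⟨hint, hres⟩ := shift_integral hfg hgf hq hW hev h
  have hmonic : (W.comp (X + C (ofPoly q))).Monic := hW.comp_X_add_C _
  have hdeg : (W.comp (X + C (ofPoly q))).natDegree = W.natDegree := by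
    rw [natDegree_comp, natDegree_X_add_C, mul_one]
  have hev' : ∀ w, (W.comp (X + C (ofPoly q))).eval w = W.eval (ofPoly q + w) := by
    intro w
    simp [eval_comp, add_comm]
  set G := W.comp (X + C (ofPoly q))
  -- The reduction of G modulo x⁻¹; it is monic of the same degree because G is.
  set H : ℂ[X] := ∑ i ∈ Finset.range (G.natDegree + 1), monomial i (coeffX (G.coeff i) 0) with hH
  have hHc : H.coeff G.natDegree = 1 := by
    simp only [hH, finsetSum_coeff, coeff_monomial]
    rw [Finset.sum_ite_eq' (Finset.range _), if_pos (by simp), hmonic.coeff_natDegree,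
      ← map_one ofPoly]
    simpa using coeffX_ofPoly 1 0
  have hHdeg : H.degree ≠ 0 := by
    intro h0
    rw [eq_C_of_degree_eq_zero h0, coeff_C_of_ne_zero (by omega)] at hHc
    exact zero_ne_one hHc
  obtain ⟨c₀, hc₀⟩ := IsAlgClosed.exists_root H hHdeg
  set c : ℕ → ℂ := fun l => (seriesPoly f g q l).eval c₀ with hc
  have hc0 : c 0 = c₀ := by simp [hc, seriesPoly, coeffPoly]
  have hcs : ∀ l, c l = (seriesPoly f g q l).eval (c 0) := fun l => by rw [hc0]
  have hsol : IsSolution f g (ofPoly q + tail c) := by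
    rw [(isBalance_I hfg hgf).isSolution_iff hq, ← (isBalance_I hfg hgf).coeff_linear hq,
      coeff_linear_I hfg hgf hq, hres hn]
    exact ⟨by ring, hcs⟩
  refine ⟨c, hsol, hcs, ?_⟩
  obtain ⟨h0, h1⟩ := eval_ordLE_zero hint (ordLE_tail c)
  have h2 : coeffX (tail c) 0 = c₀ := by simpa [hc0] using coeffX_tail_neg c 0
  have h3 : coeffX (G.eval (tail c)) 0 = 0 := by
    rw [h1, h2, ← hc₀.eq_zero, hH, eval_finsetSum]
    simp only [eval_monomial]
  have hE := eval_vectorField hsol W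
  rw [h, eval_mul, eval_C, ← hev'] at hE
  rw [IsRoot, ← hev']
  by_contra hne
  obtain ⟨s, hs, hs0⟩ := exists_leading hne
  have hsneg : s ≠ 0 := by
    rintro rfl
    exact hs0 h3
  have hy : OrdLE (ofPoly q + tail c) ((f.natDegree + 1 : ℕ) : ℤ) :=
    (ordLE_ofPoly_of_natDegree_le hq.natDegree_eq.le).add ((ordLE_tail c).mono (by omega))
  have hylead : coeffX (ofPoly q + tail c) ((f.natDegree + 1 : ℕ) : ℤ) = leadI f := by
    rw [coeffX_add, ordLE_tail c _ (by push_cast; omega), coeffX_ofPoly, ← hq.natDegree_eq,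
      coeff_natDegree, hq.leadingCoeff_eq, add_zero]
  -- At x^(m + 1 + s - 1) the left side vanishes, since ev has order at most m - 1, while the right
  -- side is the leading coefficient of y times s times that of W(y).
  have h4 := hy.coeffX_mul hs.derivX
  rw [hylead, coeffX_derivX, ← hE, hev.mul hs _ (by push_cast; omega)] at h4
  exact mul_ne_zero (isBalance_I hfg hgf).ne_zero
    (mul_ne_zero (Int.cast_ne_zero.mpr hsneg) hs0) h4.symm

theorem ordLE_cofactor_I {q : ℂ[X]} (hfg : f.natDegree < g.natDegree)
    (hgf : g.natDegree < 2 * f.natDegree + 1)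
    (hq : IsPrincipalPart f g (leadI f) (f.natDegree + 1) q)
    (c : ℕ → ℂ) :
    OrdLE (ofPoly f + derivX (ofPoly q + tail c)) (f.natDegree - 1) := by
  rw [derivX_add, derivX_ofPoly, ← add_assoc, ← map_add]
  refine ((ordLE_linear_I hfg hgf hq).pred ?_).add ((ordLE_tail c).derivX.mono (by omega))
  rw [coeffX_ofPoly, coeff_linear_I hfg hgf hq]

/-- Induction on the degree. The bound on the eigenvalue survives division by X - y, because f + y_x
has order at most m - 1 for every series y = q + tail. -/
theorem exists_factorization {q : ℂ[X]} (hfg : f.natDegree < g.natDegree)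
    (hgf : g.natDegree < 2 * f.natDegree + 1)
    (hq : IsPrincipalPart f g (leadI f) (f.natDegree + 1) q)
    (n : ℕ) : ∀ (W : (LaurentSeries ℂ)[X]) (ev : LaurentSeries ℂ),
    W.Monic → W.natDegree = n → OrdLE ev (f.natDegree - 1) →
    vectorField f g W = C ev * W →
    ∃ c : Fin n → ℕ → ℂ, (∀ j, IsSolution f g (ofPoly q + tail (c j))) ∧
      (∀ j l, c j l = (seriesPoly f g q l).eval (c j 0)) ∧
      W = ∏ j, (X - C (ofPoly q + tail (c j))) ∧
      ev = -∑ j, (ofPoly f + derivX (ofPoly q + tail (c j))) := by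
  induction n with
  | zero =>
    intro W ev hW hn _ h
    have hW1 : W = 1 := hW.natDegree_eq_zero.mp hn
    refine ⟨Fin.elim0, fun j => j.elim0, fun j => j.elim0, by simpa using hW1, ?_⟩
    subst hW1
    rw [vectorField, ← C_1, dX_C, derivX_one, derivative_C, C_0, C_1] at h
    have h0 : C ev = 0 := by linear_combination -h
    simpa using h0
  | succ n ih =>
    intro W ev hW hn hev h
    obtain ⟨c, hsol, hcs, hroot⟩ := exists_root hfg hgf hq hW (by omega) hev h
    obtain ⟨V, rfl⟩ := dvd_iff_isRoot.mpr hroot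
    have hV : V.Monic := (monic_X_sub_C _).of_mul_monic_left hW
    have hVn : V.natDegree = n := by
      rw [(monic_X_sub_C _).natDegree_mul hV, natDegree_X_sub_C] at hn
      omega
    obtain ⟨c', h1, h2, h3, h4⟩ := ih V _ hV hVn (hev.add (ordLE_cofactor_I hfg hgf hq c))
      (vectorField_of_mul hsol h)
    refine ⟨Fin.cons c c', ?_, ?_, ?_, ?_⟩
    · exact Fin.cases hsol h1
    · exact Fin.cases hcs h2
    · rw [Fin.prod_univ_succ, Fin.cons_zero]
      simp only [Fin.cons_succ]
      rw [← h3]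
    · rw [Fin.sum_univ_succ, Fin.cons_zero]
      simp only [Fin.cons_succ]
      linear_combination h4

/-! ### Invariant algebraic curves -/

theorem natDegree_eq_zero_of_derivative_eq_mul {a b : ℂ[X]} (h : derivative a = b * a) :
    a.natDegree = 0 := by
  by_contra h0
  have hlt := natDegree_derivative_lt h0
  have ha : a ≠ 0 := by
    rintro rfl
    exact h0 natDegree_zero
  by_cases hb : b = 0
  · rw [hb, zero_mul] at h
    exact h0 (derivative_eq_zero.mp h)
  · rw [h, natDegree_mul hb ha] at hlt
    omega

/-- The field raises the degree in y by at most one, so L has degree at most 1. At the power of y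
just above the top one only y F_x contributes, so the leading coefficient μ(x) satisfies μ' = L₁ μ;
by degrees μ is constant and L₁ = 0. -/
theorem IsLienardInvariantCurve.leadingCoeff_cofactor {F L : ℂ[X][Y]}
    (h : IsLienardInvariantCurve f g F L) :
    ∃ (μ : ℂ) (ev : ℂ[X]), μ ≠ 0 ∧ F.leadingCoeff = C μ ∧ F.natDegree ≠ 0 ∧ L = C ev := by
  obtain ⟨hF, h⟩ := h
  have hF0 : F ≠ 0 := fun h0 => hF 0 (by rw [h0, C_0, C_0])
  have hpart : (partialX F).natDegree ≤ F.natDegree :=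
    natDegree_le_iff_coeff_eq_zero.mpr fun i hi => by
      rw [coeff_partialX, coeff_eq_zero_of_natDegree_lt hi, derivative_zero]
  have hder : (derivative F).natDegree ≤ F.natDegree := natDegree_derivative_le_of_le (by omega)
  have hQ : (-(C f * Y) - C g : ℂ[X][Y]).natDegree ≤ 1 := by
    refine (natDegree_sub_le _ _).trans (max_le ?_ (by simp))
    rw [natDegree_neg]
    exact (natDegree_C_mul_le f X).trans natDegree_X_le
  have hL1 : L.natDegree ≤ 1 := by
    by_cases hL : L = 0
    · simp [hL]
    have h1 : (L * F).natDegree ≤ 1 + F.natDegree := by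
      rw [← h]
      exact natDegree_add_le_of_degree_le (natDegree_mul_le_of_le natDegree_X_le hpart)
        (natDegree_mul_le_of_le hQ hder)
    rw [natDegree_mul hL hF0] at h1
    omega
  have hdertop : (derivative F).coeff F.natDegree = 0 := by
    rw [coeff_derivative, coeff_eq_zero_of_natDegree_lt (Nat.lt_succ_self _), zero_mul]
  have htop : derivative F.leadingCoeff = L.coeff 1 * F.leadingCoeff := by
    have h1 := coeff_mul_add_eq_of_natDegree_le hL1 (le_refl F.natDegree)
    rw [← h, coeff_add, coeff_mul_add_eq_of_natDegree_le hQ hder, hdertop, mul_zero, add_zero,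
      coeff_mul_add_eq_of_natDegree_le natDegree_X_le hpart, coeff_partialX, coeff_X_one,
      one_mul] at h1
    exact h1
  have hlc : F.leadingCoeff ≠ 0 := leadingCoeff_ne_zero.mpr hF0
  obtain ⟨μ, hμ⟩ : ∃ μ, F.leadingCoeff = C μ :=
    ⟨_, eq_C_of_natDegree_eq_zero (natDegree_eq_zero_of_derivative_eq_mul htop)⟩
  refine ⟨μ, L.coeff 0, ?_, hμ, fun hN => hF μ ?_, ?_⟩
  · rintro rfl
    exact hlc (hμ.trans C_0)
  · rw [← hμ, leadingCoeff, hN]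
    exact eq_C_of_natDegree_eq_zero hN
  · rw [hμ, derivative_C, ← hμ] at htop
    have hc1 : L.coeff 1 = 0 := (mul_eq_zero.mp htop.symm).resolve_right hlc
    exact eq_C_of_natDegree_le_zero (natDegree_le_pred_of_coeff hL1 hc1)

theorem dX_map (F : ℂ[X][Y]) : dX (F.map ofPoly) = (partialX F).map ofPoly := by
  ext1 i
  rw [coeff_dX, coeff_map, coeff_map, coeff_partialX, derivX_ofPoly]

theorem vectorField_map (F : ℂ[X][Y]) : vectorField f g (F.map ofPoly) =
    (Y * partialX F + (-(C f * Y) - C g) * derivative F).map ofPoly := by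
  rw [vectorField, dX_map, derivative_map]
  simp only [Polynomial.map_add, Polynomial.map_mul, Polynomial.map_sub, Polynomial.map_neg,
    map_X, map_C]
  ring

theorem vectorField_C_mul_map (a : ℂ) (F : ℂ[X][Y]) : vectorField f g ((C (C a) * F).map ofPoly) =
    C (ofPoly (C a)) * vectorField f g (F.map ofPoly) := by
  rw [Polynomial.map_mul, map_C, vectorField_mul]
  have h : vectorField f g (C (ofPoly (C a))) = 0 := by
    rw [vectorField, dX_C, derivX_ofPoly, derivative_C, derivative_C, map_zero, C_0]
    ring
  rw [h, mul_zero, add_zero]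

theorem polyPart_map (F : ℂ[X][Y]) : polyPart (F.map ofPoly) = F := by
  ext j i
  rw [coeff_polyPart, coeff_map, coeffX_ofPoly]

/-- Gauss's lemma keeps G irreducible over the fraction field, irreducible polynomials in
characteristic zero are separable, and separability survives the field extension into K. -/
theorem separable_map_of_injective {R K : Type*} [CommRing R] [IsDomain R] [IsIntegrallyClosed R]
    [CharZero R] [Field K] {φ : R →+* K} (hφ : Function.Injective φ) {G : R[X]} (hG : G.Monic)
    (hirr : Irreducible G) : (G.map φ).Separable := by
  have h1 := (hG.irreducible_iff_irreducible_map_fraction_map (K := FractionRing R)).mp hirr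
  have : CharZero (FractionRing R) :=
    charZero_of_injective_algebraMap (IsFractionRing.injective R (FractionRing R))
  have h2 : (IsFractionRing.lift (K := FractionRing R) hφ).comp
      (algebraMap R (FractionRing R)) = φ :=
    RingHom.ext fun p => IsFractionRing.lift_algebraMap hφ p
  rw [← h2, ← Polynomial.map_map]
  exact h1.separable.map

/-- Splitting off the factor of type (II). -/
theorem exists_factor_solution {z ev : LaurentSeries ℂ} (hz : IsSolution f g z)
    {W : (LaurentSeries ℂ)[X]} (hW : W.Monic) (hsep : W.Separable)
    (h : vectorField f g W = C ev * W) :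
    ∃ (k : ℕ) (V : (LaurentSeries ℂ)[X]), (k = 0 ∨ k = 1) ∧ V.Monic ∧ W = V * (X - C z) ^ k ∧
      V.eval z ≠ 0 ∧
      vectorField f g V = C (ev + (k : LaurentSeries ℂ) * (ofPoly f + derivX z)) * V := by
  by_cases h0 : W.eval z = 0
  · obtain ⟨V, rfl⟩ := dvd_iff_isRoot.mpr h0
    refine ⟨1, V, Or.inr rfl, (monic_X_sub_C _).of_mul_monic_left hW, by rw [pow_one, mul_comm],
      fun hV => ?_, ?_⟩
    · exact not_isUnit_X_sub_C z (isUnit_of_self_mul_dvd_separable hsep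
        (mul_dvd_mul_left _ (dvd_iff_isRoot.mpr hV)))
    · rw [Nat.cast_one, one_mul]
      exact vectorField_of_mul hz h
  · refine ⟨0, W, Or.inl rfl, hW, by rw [pow_zero, mul_one], h0, ?_⟩
    rw [Nat.cast_zero, zero_mul, add_zero]
    exact h

/-- In ev V(z) = z (V(z))_x the derivative lowers the order by at least one, and V(z) cancels. With
z of type (II) this gives order at most m - 1; a type (I) series would only give m. -/
theorem ordLE_eigenvalue {z ev : LaurentSeries ℂ} (hz : IsSolution f g z) {d : ℤ}
    (hzd : OrdLE z d) {V : (LaurentSeries ℂ)[X]} (hV : V.eval z ≠ 0)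
    (h : vectorField f g V = C ev * V) : OrdLE ev (d - 1) := by
  have hE := eval_vectorField hz V
  rw [h, eval_mul, eval_C] at hE
  obtain ⟨s, hs, hs0⟩ := exists_leading hV
  refine ordLE_of_mul hs hs0 ?_
  rw [hE]
  exact (hzd.mul hs.derivX).mono (by omega)

theorem eq_zero_of_ofPoly_eq_derivX {P : ℂ[X]} {T : LaurentSeries ℂ} (hT : OrdLE T 0)
    (h : ofPoly P = derivX T) : P = 0 := by
  ext i
  rw [← coeffX_ofPoly, h, hT.derivX _ (by omega), coeff_zero]

theorem ordLE_sum {ι : Type*} (s : Finset ι) {y : ι → LaurentSeries ℂ} {d : ℤ}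
    (h : ∀ i, OrdLE (y i) d) : OrdLE (∑ i ∈ s, y i) d := fun j hj => by
  rw [coeffX_sum]
  exact Finset.sum_eq_zero fun i _ => h i j hj

theorem ordLE_natCast_mul {y : LaurentSeries ℂ} {d : ℤ} (hy : OrdLE y d) (n : ℕ) :
    OrdLE ((n : LaurentSeries ℂ) * y) d := fun j hj => by
  rw [mul_comm, coeffX_mul_natCast, hy j hj, zero_mul]

/-- The difference of the two sides is a polynomial and also the derivative of a series of order at
most 0, which contains only negative powers of x. -/
theorem cofactor_eq {q p ev : ℂ[X]} {N k : ℕ} (hk : k ≤ N) (c : Fin (N - k) → ℕ → ℂ) (b : ℕ → ℂ)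
    (h : ofPoly ev + (k : LaurentSeries ℂ) * (ofPoly f + derivX (ofPoly p + tail b)) =
      -∑ j, (ofPoly f + derivX (ofPoly q + tail (c j)))) :
    ev = -((N : ℂ[X]) * f) - ((N : ℂ[X]) - (k : ℂ[X])) * derivative q
      - (k : ℂ[X]) * derivative p := by
  have hT : OrdLE (-(∑ j, tail (c j) + (k : LaurentSeries ℂ) * tail b)) 0 :=
    ((ordLE_sum _ fun j => ordLE_tail (c j)).add (ordLE_natCast_mul (ordLE_tail b) k)).neg
  have hder : derivX ((k : LaurentSeries ℂ) * tail b) =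
      (k : LaurentSeries ℂ) * derivX (tail b) := by
    rw [derivX_mul, ← map_natCast ofPoly k, derivX_ofPoly, derivative_natCast, map_zero, mul_zero,
      add_zero]
  rw [← sub_eq_zero]
  refine eq_zero_of_ofPoly_eq_derivX hT ?_
  rw [derivX_neg, derivX_add, derivX_sum, hder]
  simp only [derivX_add, derivX_ofPoly, Finset.sum_add_distrib, Finset.sum_const,
    Finset.card_univ, Fintype.card_fin, nsmul_eq_mul, Nat.cast_sub hk] at h
  simp only [map_sub, map_neg, map_mul, map_natCast]
  linear_combination h

theorem invariantCurve_structure {q p : ℂ[X]} {b : ℕ → ℂ} (hfg : f.natDegree < g.natDegree)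
    (hgf : g.natDegree < 2 * f.natDegree + 1)
    (hq : IsPrincipalPart f g (leadI f) (f.natDegree + 1) q)
    (hp : IsPrincipalPart f g (leadII f g) (g.natDegree - f.natDegree) p)
    (hb : IsSolution f g (ofPoly p + tail b))
    {F L : ℂ[X][Y]} (hirr : Irreducible F)
    (h : IsLienardInvariantCurve f g F L) :
    ∃ (N k : ℕ) (c : Fin (N - k) → ℕ → ℂ) (μ : ℂ),
      1 ≤ N ∧ (k = 0 ∨ k = 1) ∧ μ ≠ 0 ∧
      (∀ j, IsSolution f g (ofPoly q + tail (c j))) ∧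
      (∀ i j, i ≠ j → c i 0 ≠ c j 0) ∧
      (∀ j l, c j l = (seriesPoly f g q l).eval (c j 0)) ∧
      F = C (C μ) * polyPart
        ((∏ j, (X - C (ofPoly q + tail (c j)))) * (X - C (ofPoly p + tail b)) ^ k) ∧
      L = C (-((N : ℂ[X]) * f) - ((N : ℂ[X]) - (k : ℂ[X])) * derivative q
        - (k : ℂ[X]) * derivative p) := by
  obtain ⟨μ, ev, hμ, hlc, hN, rfl⟩ := h.leadingCoeff_cofactor
  have hCC : C (C μ) * (C (C μ⁻¹) * F) = F := by
    rw [← mul_assoc, ← C_mul, ← C_mul, mul_inv_cancel₀ hμ, C_1, C_1, one_mul]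
  have hunit : IsUnit (C (C μ⁻¹) : ℂ[X][Y]) :=
    ((IsUnit.mk0 _ (inv_ne_zero hμ)).map C).map C
  have hGirr : Irreducible (C (C μ⁻¹) * F) := (irreducible_isUnit_mul hunit).mpr hirr
  have hGmonic : (C (C μ⁻¹) * F).Monic := by
    rw [Monic, leadingCoeff_mul, leadingCoeff_C, hlc, ← C_mul, inv_mul_cancel₀ hμ, C_1]
  have hWvf : vectorField f g ((C (C μ⁻¹) * F).map ofPoly) =
      C (ofPoly ev) * (C (C μ⁻¹) * F).map ofPoly := by
    rw [vectorField_C_mul_map, vectorField_map, h.2, Polynomial.map_mul, Polynomial.map_mul, map_C,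
      map_C]
    ring
  have hGdeg : ((C (C μ⁻¹) * F).map ofPoly).natDegree = F.natDegree := by
    rw [hGmonic.natDegree_map, natDegree_C_mul]
    exact C_ne_zero.mpr (inv_ne_zero hμ)
  have hsep := separable_map_of_injective ofPoly_injective hGmonic hGirr
  obtain ⟨k, V, hk, hVmonic, hWV, hVz, hVvf⟩ := exists_factor_solution hb (hGmonic.map ofPoly)
    hsep hWvf
  -- The order n - m of the type (II) series is at most m, as n < 2m + 1.
  have hzd : OrdLE (ofPoly p + tail b) (f.natDegree : ℤ) :=
    (ordLE_ofPoly_of_natDegree_le (by rw [hp.natDegree_eq]; omega)).add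
      ((ordLE_tail b).mono (by omega))
  have hdeg : V.natDegree + k = F.natDegree := by
    rw [← hGdeg, hWV, hVmonic.natDegree_mul ((monic_X_sub_C _).pow k),
      natDegree_pow, natDegree_X_sub_C, mul_one]
  obtain ⟨c, hsol, hcs, hprod, hev⟩ := exists_factorization hfg hgf hq (F.natDegree - k) V _
    hVmonic (by omega) (ordLE_eigenvalue hb hzd hVz hVvf) hVvf
  refine ⟨F.natDegree, k, c, μ, by omega, hk, hμ, hsol, ?_, hcs, ?_, ?_⟩
  -- Equal constant terms give equal series, hence a repeated root of a separable polynomial.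
  · intro i j hij h0
    rw [hWV, hprod] at hsep
    refine hij (hsep.of_mul_left.injective_of_prod_X_sub_C ?_)
    have hc : c i = c j := funext fun l => by rw [hcs i l, hcs j l, h0]
    rw [hc]
  · rw [← hprod, ← hWV, polyPart_map, hCC]
  · rw [cofactor_eq (by omega) c b hev]

end Lienard

end

open Lienard in
theorem theorem5 (f g : ℂ[X]) (hfg : f.natDegree < g.natDegree)
    (hgf : g.natDegree < 2 * f.natDegree + 1) :
    -- `q`, `p`, the coefficients `b` of the series (II), and the expressions `Φ` of the
    -- coefficients of the series (I) through the free one depend only on `f` and `g`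
    ∃ (q p : ℂ[X]) (b : ℕ → ℂ) (Φ : ℕ → ℂ[X]),
      -- `q` has the stated form and is uniquely determined
      IsPrincipalPart f g (leadI f) (f.natDegree + 1) q ∧
      (∀ r : ℂ[X], IsPrincipalPart f g (leadI f) (f.natDegree + 1) r → r = q) ∧
      -- `p` has the stated form and is uniquely determined
      IsPrincipalPart f g (leadII f g) (g.natDegree - f.natDegree) p ∧
      (∀ r : ℂ[X], IsPrincipalPart f g (leadII f g) (g.natDegree - f.natDegree) r → r = p) ∧
      -- every series of type (I) has polynomial part `q` up to the free constant term, which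
      -- determines all the other coefficients
      (∀ y : LaurentSeries ℂ, IsSolution f g y →
        HasLeadingTerm y (leadI f) ((f.natDegree : ℤ) + 1) →
        ∃ c : ℕ → ℂ, y = ofPoly q + tail c ∧ ∀ l, 1 ≤ l → c l = (Φ l).eval (c 0)) ∧
      -- the series of type (II) exists and is uniquely determined
      IsSolution f g (ofPoly p + tail b) ∧
      (∀ y : LaurentSeries ℂ, IsSolution f g y →
        HasLeadingTerm y (leadII f g) ((g.natDegree : ℤ) - f.natDegree) →
        y = ofPoly p + tail b) ∧
      -- the structure of irreducible invariant algebraic curves and of their cofactors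
      (∀ F L : ℂ[X][Y], Irreducible F → IsLienardInvariantCurve f g F L →
        ∃ (N k : ℕ) (c : Fin (N - k) → ℕ → ℂ) (μ : ℂ),
          1 ≤ N ∧ (k = 0 ∨ k = 1) ∧ μ ≠ 0 ∧
          (∀ j, IsSolution f g (ofPoly q + tail (c j))) ∧
          (∀ i j, i ≠ j → c i 0 ≠ c j 0) ∧
          (∀ j l, 1 ≤ l → c j l = (Φ l).eval (c j 0)) ∧
          F = C (C μ) * polyPart
            ((∏ j, (X - C (ofPoly q + tail (c j)))) * (X - C (ofPoly p + tail b)) ^ k) ∧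
          L = C (-((N : ℂ[X]) * f) - ((N : ℂ[X]) - (k : ℂ[X])) * derivative q
            - (k : ℂ[X]) * derivative p)) := by
  have hI := isBalance_I hfg hgf
  have hII := isBalance_II hfg hgf
  obtain ⟨q, hq⟩ := hI.exists_principalPart
  obtain ⟨p, hp⟩ := hII.exists_principalPart
  have hf0 : f.leadingCoeff ≠ 0 := by simpa using hII.linear_ne 1 one_ne_zero
  -- The solution of the index 0 equation, whose linear factor is f₀ since A = 0.
  set b₀ : ℂ := -(residual f g p).coeff f.natDegree / f.leadingCoeff with hb₀
  set b : ℕ → ℂ := fun l => (seriesPoly f g p l).eval b₀ with hb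
  have hb0 : b 0 = b₀ := by simp [hb, seriesPoly, coeffPoly]
  have hsol : IsSolution f g (ofPoly p + tail b) := by
    rw [hII.isSolution_iff hp, hb0]
    refine ⟨?_, fun l => rfl⟩
    rw [hb₀]
    field_simp
    ring
  refine ⟨q, p, b, seriesPoly f g q, hq, fun r hr => hI.principalPart_unique hr hq, hp,
    fun r hr => hII.principalPart_unique hr hp, fun y hy hlead => ?_, hsol,
    fun y hy hlead => ?_, fun F L hF hL => ?_⟩
  · obtain ⟨c, rfl⟩ := hI.exists_eq_add_tail hq hy (by exact_mod_cast hlead)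
    exact ⟨c, rfl, fun l _ => ((hI.isSolution_iff hq c).mp hy).2 l⟩
  · rw [← Nat.cast_sub hfg.le] at hlead
    obtain ⟨c, rfl⟩ := hII.exists_eq_add_tail hp hy hlead
    obtain ⟨h0, h1⟩ := (hII.isSolution_iff hp c).mp hy
    have hc0 : c 0 = b₀ := by
      rw [hb₀, eq_div_iff hf0]
      linear_combination h0
    have hcb : c = b := funext fun l => by rw [h1 l, hc0]
    rw [hcb]
  · obtain ⟨N, k, c, μ, h1, h2, h3, h4, h5, h6, h7, h8⟩ :=
      invariantCurve_structure hfg hgf hq hp hsol hF hL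
    exact ⟨N, k, c, μ, h1, h2, h3, h4, h5, fun j l _ => h6 j l, h7, h8⟩
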